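/- Let $h$ be an entire function of minimal exponential type, that is, for every $\varepsilon>0$ one has $h(z)=O(e^{\varepsilon|z|})$ as $z\to\infty$. Put $c_n=h(0)h(1)\cdots h(n)$ for $n\ge 0$, and assume in addition that $$-\log|c_n|=\frac1\rho\, n\log n-cn+o(n),\qquad n\to\infty,$$ with some real constants $\rho>0$ and $c$. Let $\alpha$ be an irrational real number. Then the series $$f(z)=\sum_{n=0}^\infty c_n e^{2\pi i n^2\alpha}z^n$$ converges for every $z\in\mathbf C$, its sum $f$ is an entire function, and, with $M(r,f)=\max_{|z|=r}|f(z)|$: 1. $f$ has order $\rho$, that is, $\limsup_{r\to\infty}\frac{\log\log M(r,f)}{\log r}=\rho$; 2. $f$ has normal type, that is, $0<\limsup_{r\to\infty}r^{-\rho}\log M(r,f)<\infty$; 3. $f$ has completely regular growth, that is, $\log|f|$ is locally integrable and, as $t\to\infty$, the functions $z\mapsto t^{-\rho}\log|f(tz)|$ converge in the sense of Schwartz distributions in the plane to a locally integrable function; 4. the indicator $\theta\mapsto\limsup_{r\to\infty}r^{-\rho}\log|f(re^{i\theta})|$ is equal to a finite constant, the same for all real $\theta$. -/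

import Mathlib

open Filter Topology MeasureTheory
open scoped ContDiff

noncomputable section

/-- The maximum modulus `M(r, f) = max_{|z| = r} |f z|`. -/
def maxModulus (f : ℂ → ℂ) (r : ℝ) : ℝ :=
  ⨆ z : Metric.sphere (0 : ℂ) r, ‖f z‖

/-- The order of growth `limsup_{r → ∞} log log M(r, f) / log r`. -/
def growthOrder (f : ℂ → ℂ) : EReal :=
  limsup (fun r : ℝ =>
    ((Real.log (Real.log (maxModulus f r)) / Real.log r : ℝ) : EReal)) atTop

/-- The type with respect to the exponent `ρ`, `limsup_{r → ∞} log M(r, f) / r ^ ρ`. -/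
def growthType (ρ : ℝ) (f : ℂ → ℂ) : EReal :=
  limsup (fun r : ℝ => ((Real.log (maxModulus f r) / r ^ ρ : ℝ) : EReal)) atTop

/-- Normal type with respect to the exponent `ρ`: the type is positive and finite. -/
def HasNormalType (ρ : ℝ) (f : ℂ → ℂ) : Prop :=
  0 < growthType ρ f ∧ growthType ρ f < ⊤

/-- An entire function is of minimal exponential type if `log⁺ |h z| = o(|z|)`, that is,
`h z = O(exp (ε |z|))` as `z → ∞`, for every `ε > 0`. -/
def IsMinimalExponentialType (h : ℂ → ℂ) : Prop :=
  Differentiable ℂ h ∧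
    ∀ ε : ℝ, 0 < ε →
      h =O[Bornology.cobounded ℂ] fun z : ℂ => Real.exp (ε * ‖z‖)

/-- The Phragmén–Lindelöf indicator with respect to the exponent `ρ`,
`limsup_{r → ∞} r ^ (-ρ) log |f (r e^{iθ})|`, where `log 0 = -∞`. -/
def growthIndicator (ρ : ℝ) (f : ℂ → ℂ) (θ : ℝ) : EReal :=
  limsup (fun r : ℝ =>
    ENNReal.log ‖f (r * Complex.exp (θ * Complex.I))‖ₑ / ((r ^ ρ : ℝ) : EReal)) atTop

/-- Completely regular growth with respect to the exponent `ρ`: the functions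
`z ↦ t ^ (-ρ) log |f (t z)|` converge as `t → ∞` in the space of distributions in the plane.
(For families indexed by `t → ∞`, this is convergence of the pairing with every test function;
a distributional limit of the subharmonic functions `t ^ (-ρ) log |f (t z)|` is again given by a
subharmonic, hence locally integrable, function `u`.) -/
def HasCompletelyRegularGrowth (ρ : ℝ) (f : ℂ → ℂ) : Prop :=
  LocallyIntegrable (fun z : ℂ => Real.log ‖f z‖) ∧
    ∃ u : ℂ → ℝ, LocallyIntegrable u ∧
      ∀ φ : ℂ → ℝ, ContDiff ℝ ∞ φ → HasCompactSupport φ →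
        Tendsto (fun t : ℝ => ∫ z : ℂ, t ^ (-ρ) * Real.log ‖f (t * z)‖ * φ z) atTop
          (𝓝 (∫ z : ℂ, u z * φ z))

/-- The indicator with respect to the exponent `ρ` is a (finite) constant. -/
def HasConstantIndicator (ρ : ℝ) (f : ℂ → ℂ) : Prop :=
  ∃ κ : ℝ, ∀ θ : ℝ, growthIndicator ρ f θ = κ

/-- `c n = h 0 * h 1 * ⋯ * h n`. -/
def prodCoeff (h : ℂ → ℂ) (n : ℕ) : ℂ :=
  ∏ k ∈ Finset.range (n + 1), h k

end

/-!
The mechanism is a rotation invariance. Since `(n + 1)² = n² + 2n + 1`, the sum `f` satisfies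
`f z = c₀ + q z · (H f)(q² z)`, where `q = exp (2πiα)` and `H` multiplies the `n`-th Taylor
coefficient by `h (n + 1)`. In the variable `ζ = log z` the operator `H` is `h (1 + d/dζ)`, and because
`h` has minimal exponential type this differential operator of infinite order is local: it is
controlled by the values of the function in an arbitrarily small disc
(`norm_tsum_multiplier_le`). So wherever `|f|` is large, it is almost as large near the point rotated
by the angle `4πα`; iterating, and using that `α` is irrational, it is almost as large as its maximum
on the circle near *every* point of the circle (`eventually_forall_exists_large`).

The asymptotics of `|c_n|` give the size of the maximum: with `σ = exp (ρ c - 1) / ρ`, the maximal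
term and the majorant series both have logarithm `σ r ^ ρ + o(r ^ ρ)`. This settles order and type.
Thus `log |f|` is nowhere much larger than `σ |z| ^ ρ` and near every point it is about that large.
Subharmonicity turns this into the remaining claims. Jensen's formula on small discs bounds the
area integral of `σ |z| ^ ρ - t ^ (-ρ) log |f (t z)|` by its value at a good point near the centre
(`lintegral_ball_sub_log_le`), and averaging over the centres gives convergence in `L¹` on compact sets
to `σ |z| ^ ρ`, hence convergence of distributions. If `log |f|` stayed below `(σ - ε) r ^ ρ` on a ray,
a two-constants estimate (`norm_le_exp_of_le_on_segment`) would make `|f|` small in full neighbourhoods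
of points of the ray, which is impossible; so the indicator is `σ` in every direction.

The last two steps use only the hypotheses named `hU` (the upper bound) and `hL` (largeness near every
point) below.
-/

/-! ### Power series and multiplier operators -/

theorem hasFPowerSeriesOnBall_of_hasSum {a : ℕ → ℂ} {F : ℂ → ℂ}
    (hF : ∀ z, HasSum (fun n => a n * z ^ n) (F z)) :
    HasFPowerSeriesOnBall F (FormalMultilinearSeries.ofScalars ℂ a) 0 ⊤ := by
  have hr : (FormalMultilinearSeries.ofScalars ℂ a).radius = ⊤ := by
    refine FormalMultilinearSeries.radius_eq_top_of_summable_norm _ fun r => ?_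
    have := (hF (r : ℂ)).summable.norm
    simpa [FormalMultilinearSeries.ofScalars_norm] using this
  refine ⟨hr.ge, ENNReal.zero_lt_top, fun {y} _ => ?_⟩
  simpa [FormalMultilinearSeries.ofScalars_apply_eq, mul_comm] using hF y

theorem differentiable_of_hasSum {a : ℕ → ℂ} {F : ℂ → ℂ}
    (hF : ∀ z, HasSum (fun n => a n * z ^ n) (F z)) : Differentiable ℂ F := by
  have := (hasFPowerSeriesOnBall_of_hasSum hF).differentiableOn
  rw [Metric.eball_top] at this
  exact differentiableOn_univ.1 this

/-- Cauchy's inequality for the coefficients of an everywhere convergent power series. -/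
theorem norm_coeff_mul_pow_le {a : ℕ → ℂ} {F : ℂ → ℂ}
    (hF : ∀ z, HasSum (fun n => a n * z ^ n) (F z)) {r B : ℝ} (hr : 0 < r)
    (hB : ∀ z, ‖z‖ = r → ‖F z‖ ≤ B) (n : ℕ) : ‖a n‖ * r ^ n ≤ B := by
  have h1 := (hasFPowerSeriesOnBall_of_hasSum hF)
  have h2 := h1.factorial_smul 1 n
  rw [← iteratedDeriv_eq_iteratedFDeriv] at h2
  have h3 := Complex.norm_iteratedDeriv_le_of_forall_mem_sphere_norm_le n hr
    (differentiable_of_hasSum hF).diffContOnCl (c := 0) (C := B)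
    (fun z hz => hB z (by simpa using hz))
  rw [← h2] at h3
  have hn : (0 : ℝ) < n.factorial := by exact_mod_cast n.factorial_pos
  simp only [FormalMultilinearSeries.ofScalars_apply_eq, one_pow, smul_eq_mul, mul_one,
    nsmul_eq_mul, norm_mul, Complex.norm_natCast] at h3
  rw [mul_div_assoc] at h3
  exact (le_div_iff₀ (by positivity)).1 (le_of_mul_le_mul_left h3 hn)

theorem IsMinimalExponentialType.exists_norm_le {h : ℂ → ℂ} (hh : IsMinimalExponentialType h)
    {ε : ℝ} (hε : 0 < ε) : ∃ K, ∀ z, ‖h (z + 1)‖ ≤ K * Real.exp (ε * ‖z‖) := by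
  obtain ⟨C, hC0, hC⟩ := (hh.2 ε hε).exists_pos
  rw [Asymptotics.IsBigOWith] at hC
  rw [Metric.cobounded_eq_cocompact, (Filter.hasBasis_cocompact).eventually_iff] at hC
  obtain ⟨s, hs, hC⟩ := hC
  obtain ⟨M, hM⟩ := hs.exists_bound_of_continuousOn hh.1.continuous.continuousOn
  refine ⟨C * Real.exp ε + |M|, fun z => ?_⟩
  have h1 : 1 ≤ Real.exp (ε * ‖z‖) := Real.one_le_exp (by positivity)
  by_cases hz : z + 1 ∈ s
  · have := (hM _ hz).trans (le_abs_self M)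
    have h2 : 0 < C * Real.exp ε := by positivity
    nlinarith [abs_nonneg M]
  · have h2 := hC hz
    have h3 : ‖z + 1‖ ≤ ‖z‖ + 1 := (norm_add_le _ _).trans (by simp)
    have h4 : Real.exp (ε * ‖z + 1‖) ≤ Real.exp ε * Real.exp (ε * ‖z‖) := by
      rw [← Real.exp_add]
      exact Real.exp_le_exp.2 (by nlinarith)
    rw [Real.norm_of_nonneg (Real.exp_pos _).le] at h2
    nlinarith [abs_nonneg M]

/-- If `h` has minimal exponential type, the Borel transform `∑ k! b_k ξ ^ (-k-1)` of
`h (z + 1) = ∑ b_k z ^ k` converges absolutely for every `ξ ≠ 0`. -/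
theorem IsMinimalExponentialType.exists_taylor {h : ℂ → ℂ} (hh : IsMinimalExponentialType h) :
    ∃ b : ℕ → ℂ, (∀ z, HasSum (fun k => b k * z ^ k) (h (z + 1))) ∧
      ∀ δ : ℝ, 0 < δ → Summable fun k => ‖b k‖ * k.factorial * δ⁻¹ ^ k := by
  have hd : Differentiable ℂ fun z => h (z + 1) := hh.1.comp (by fun_prop)
  obtain ⟨b, hb⟩ : ∃ b : ℕ → ℂ, ∀ z, HasSum (fun k => b k * z ^ k) (h (z + 1)) := by
    refine ⟨fun k => (k.factorial : ℂ)⁻¹ * iteratedDeriv k (fun z => h (z + 1)) 0, fun z => ?_⟩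
    have := Complex.hasSum_taylorSeries_of_entire hd 0 z
    simpa only [smul_eq_mul, sub_zero, mul_assoc, mul_comm (z ^ _)] using this
  refine ⟨b, hb, ?_⟩
  intro δ hδ
  -- With `ε = δ / (2e)` and circles of radius `(k + 1) / ε`, Cauchy's inequality gives
  -- `k! ‖b k‖ ≤ K e (δ / 2) ^ k`.
  set ε : ℝ := δ / 2 / Real.exp 1 with hε_def
  have hε : 0 < ε := by positivity
  obtain ⟨K, hK⟩ := hh.exists_norm_le hε
  refine Summable.of_nonneg_of_le (fun k => by positivity) (fun k => ?_)
    ((summable_geometric_two).mul_left (K * Real.exp 1))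
  have h1 := norm_coeff_mul_pow_le hb (r := (k + 1) / ε) (B := K * Real.exp (k + 1))
    (by positivity) (fun z hz => by
      have := hK z
      rwa [hz, mul_div_cancel₀ _ hε.ne'] at this) k
  have h2 : (k.factorial : ℝ) ≤ (k + 1 : ℝ) ^ k := by
    have : k.factorial ≤ (k + 1) ^ k :=
      (Nat.factorial_le_pow k).trans (Nat.pow_le_pow_left (Nat.le_succ k) k)
    exact_mod_cast this
  calc ‖b k‖ * k.factorial * δ⁻¹ ^ k ≤ ‖b k‖ * (k + 1 : ℝ) ^ k * δ⁻¹ ^ k := by gcongr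
    _ = (‖b k‖ * ((k + 1) / ε) ^ k) * (ε * δ⁻¹) ^ k := by
        rw [div_pow, mul_pow]
        field_simp
    _ ≤ (K * Real.exp (k + 1)) * (ε * δ⁻¹) ^ k := by gcongr
    _ = K * Real.exp 1 * (1 / 2) ^ k := by
        have : ε * δ⁻¹ = (1 / 2) / Real.exp 1 := by rw [hε_def]; field_simp
        have h4 : Real.exp k = Real.exp 1 ^ k := by rw [← Real.exp_nat_mul, mul_one]
        rw [this, div_pow, Real.exp_add, h4]
        field_simp

theorem Complex.hasSum_pow_div_factorial (x : ℂ) :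
    HasSum (fun k : ℕ => x ^ k / k.factorial) (Complex.exp x) := by
  have := NormedSpace.expSeries_div_hasSum_exp (𝔸 := ℂ) x
  rwa [← Complex.exp_eq_exp_ℂ] at this

theorem Real.hasSum_pow_div_factorial (x : ℝ) :
    HasSum (fun k : ℕ => x ^ k / k.factorial) (Real.exp x) := by
  have := NormedSpace.expSeries_div_hasSum_exp (𝔸 := ℝ) x
  rwa [← Real.exp_eq_exp_ℝ] at this

section ExpSeries

variable {A : ℕ → ℂ} (hA : ∀ s : ℝ, Summable fun n => ‖A n‖ * Real.exp (n * s))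

theorem summable_mul_pow_div_factorial {A : ℕ → ℂ}
    (hA : ∀ s : ℝ, Summable fun n => ‖A n‖ * Real.exp (n * s)) (k : ℕ) :
    Summable fun n : ℕ => A n * ((n : ℂ) ^ k / k.factorial) := by
  refine Summable.of_norm_bounded (hA 1) fun n => ?_
  have h1 := Real.pow_div_factorial_le_exp (n : ℝ) n.cast_nonneg k
  simp only [norm_mul, norm_div, norm_pow, Complex.norm_natCast, mul_one]
  gcongr

/-- The Taylor expansion of `∑ A_n e ^ (nξ)` at `ξ = 0`. -/
theorem hasSum_taylor_of_expSeries {A : ℕ → ℂ}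
    (hA : ∀ s : ℝ, Summable fun n => ‖A n‖ * Real.exp (n * s)) (ξ : ℂ) :
    HasSum (fun k : ℕ => (∑' n : ℕ, A n * ((n : ℂ) ^ k / k.factorial)) * ξ ^ k)
      (∑' n : ℕ, A n * Complex.exp (n * ξ)) := by
  have hdouble : Summable fun q : ℕ × ℕ => ‖A q.1‖ * ((q.1 * ‖ξ‖) ^ q.2 / q.2.factorial) := by
    have h0 : ∀ n : ℕ, HasSum (fun k : ℕ => ‖A n‖ * ((n * ‖ξ‖) ^ k / k.factorial))
        (‖A n‖ * Real.exp (n * ‖ξ‖)) :=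
      fun n => (Real.hasSum_pow_div_factorial (n * ‖ξ‖)).mul_left ‖A n‖
    refine (summable_prod_of_nonneg fun q => ?_).2 ⟨fun n => ?_, ?_⟩
    · simp only [Pi.zero_apply]
      positivity
    · exact (h0 n).summable
    · exact (hA ‖ξ‖).congr fun n => (h0 n).tsum_eq.symm
  have hs : Summable fun q : ℕ × ℕ => A q.1 * ((q.1 * ξ) ^ q.2 / q.2.factorial) := by
    refine Summable.of_norm ?_
    simpa using hdouble
  have h1 : HasSum (fun n : ℕ => A n * Complex.exp (n * ξ)) (∑' q : ℕ × ℕ,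
      A q.1 * ((q.1 * ξ) ^ q.2 / q.2.factorial)) :=
    hs.hasSum.prod_fiberwise fun n => (Complex.hasSum_pow_div_factorial _).mul_left _
  rw [h1.tsum_eq]
  have h3 : HasSum (fun q : ℕ × ℕ => A q.2 * ((q.2 * ξ) ^ q.1 / q.1.factorial)) _ :=
    (Equiv.hasSum_iff (Equiv.prodComm ℕ ℕ)).2 hs.hasSum
  refine h3.prod_fiberwise fun k => ?_
  refine Eq.mp (congrArg (HasSum · _) (funext fun n => ?_))
    ((summable_mul_pow_div_factorial hA k).hasSum.mul_right (ξ ^ k))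
  change _ = A n * ((n * ξ) ^ k / k.factorial)
  ring

/-- Expanding `g n = ∑ b_k n ^ k` and exchanging the sums expresses the series with multipliers `g n`
through the Taylor coefficients at `ξ = 0` of `∑ A_n e ^ (nξ)`. -/
theorem tsum_multiplier_eq {A b : ℕ → ℂ} {g : ℂ → ℂ}
    (hA : ∀ s : ℝ, Summable fun n => ‖A n‖ * Real.exp (n * s))
    (hg : ∀ z, HasSum (fun k => b k * z ^ k) (g z)) {δ : ℝ} (hδ : 0 < δ)
    (hb : Summable fun k => ‖b k‖ * k.factorial * δ⁻¹ ^ k) :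
    ∑' n : ℕ, g n * A n =
      ∑' k : ℕ, b k * k.factorial * ∑' n : ℕ, A n * ((n : ℂ) ^ k / k.factorial) := by
  have hs : Summable fun q : ℕ × ℕ => (b q.1 * (q.2 : ℂ) ^ q.1) * A q.2 := by
    have h0 := hb.mul_of_nonneg (hA δ) (fun k => by positivity) (fun n => by positivity)
    refine Summable.of_norm_bounded h0 fun q => ?_
    have h1 : (q.2 * δ) ^ q.1 / q.1.factorial ≤ Real.exp (q.2 * δ) :=
      Real.pow_div_factorial_le_exp _ (by positivity) _
    calc ‖b q.1 * (q.2 : ℂ) ^ q.1 * A q.2‖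
        = ‖b q.1‖ * q.1.factorial * δ⁻¹ ^ q.1 * (‖A q.2‖ *
            ((q.2 * δ) ^ q.1 / q.1.factorial)) := by
          simp only [norm_mul, norm_pow, Complex.norm_natCast, mul_pow, inv_pow]
          field_simp
      _ ≤ _ := by gcongr
  have hL : HasSum (fun n : ℕ => g n * A n) (∑' q : ℕ × ℕ, (b q.1 * (q.2 : ℂ) ^ q.1) * A q.2) :=
    ((Equiv.hasSum_iff (Equiv.prodComm ℕ ℕ)).2 hs.hasSum).prod_fiberwise
      fun n => (hg n).mul_right _
  have hR : HasSum (fun k : ℕ => b k * k.factorial *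
        ∑' n : ℕ, A n * ((n : ℂ) ^ k / k.factorial)) (∑' q : ℕ × ℕ, (b q.1 * (q.2 : ℂ) ^ q.1) * A q.2) := by
    refine hs.hasSum.prod_fiberwise fun k => ?_
    refine Eq.mp (congrArg (HasSum · _) (funext fun n => ?_))
      ((summable_mul_pow_div_factorial hA k).hasSum.mul_left (b k * k.factorial))
    change _ = b k * (n : ℂ) ^ k * A n
    have : (k.factorial : ℂ) ≠ 0 := by exact_mod_cast k.factorial_ne_zero
    field_simp
  rw [hL.tsum_eq, hR.tsum_eq]

/-- The operator `∑ a_n e ^ (nζ) ↦ ∑ g(n) a_n e ^ (nζ)` is the infinite order differential operator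
`g(d/dζ) = ∑ b_k (d/dζ) ^ k`; the decay of the `b_k` makes it local: its value at `ζ` is bounded by
the values of the function on an arbitrarily small disc about `ζ`. -/
theorem norm_tsum_multiplier_le {a b : ℕ → ℂ} {f g : ℂ → ℂ}
    (hf : ∀ z, HasSum (fun n => a n * z ^ n) (f z))
    (hg : ∀ z, HasSum (fun k => b k * z ^ k) (g z)) {δ : ℝ} (hδ : 0 < δ)
    (hb : Summable fun k => ‖b k‖ * k.factorial * δ⁻¹ ^ k) (ζ : ℂ) {B : ℝ}
    (hB : ∀ w, ‖w - ζ‖ ≤ δ → ‖f (Complex.exp w)‖ ≤ B) :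
    ‖∑' n : ℕ, g n * (a n * Complex.exp ζ ^ n)‖ ≤ (∑' k, ‖b k‖ * k.factorial * δ⁻¹ ^ k) * B := by
  set A : ℕ → ℂ := fun n => a n * Complex.exp ζ ^ n with hA
  have hAs : ∀ s : ℝ, Summable fun n => ‖A n‖ * Real.exp (n * s) := fun s => by
    have := (hf (Complex.exp (ζ + s))).summable.norm
    convert this using 2 with n
    rw [hA]
    simp only [Complex.exp_add, norm_mul, norm_pow, mul_pow]
    rw [Complex.norm_exp (s : ℂ), Complex.ofReal_re, ← Real.exp_nat_mul]
    ring
  set p : ℕ → ℂ := fun k => ∑' n : ℕ, A n * ((n : ℂ) ^ k / k.factorial) with hp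
  have hT : ∀ ξ : ℂ, HasSum (fun k => p k * ξ ^ k) (f (Complex.exp (ζ + ξ))) := fun ξ => by
    have h2 : HasSum (fun n : ℕ => A n * Complex.exp (n * ξ)) (f (Complex.exp (ζ + ξ))) := by
      convert hf (Complex.exp (ζ + ξ)) using 2 with n
      rw [hA, Complex.exp_add, mul_pow, Complex.exp_nat_mul ξ n]
      ring
    rw [← h2.tsum_eq]
    exact hasSum_taylor_of_expSeries hAs ξ
  have hpB : ∀ k, ‖p k‖ * δ ^ k ≤ B := fun k =>
    norm_coeff_mul_pow_le hT hδ (fun ξ hξ => hB _ (by simp [hξ])) k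
  rw [tsum_multiplier_eq hAs hg hδ hb]
  refine tsum_of_norm_bounded (hb.hasSum.mul_right B) fun k => ?_
  calc ‖b k * k.factorial * p k‖ = ‖b k‖ * k.factorial * δ⁻¹ ^ k * (‖p k‖ * δ ^ k) := by
        simp only [norm_mul, Complex.norm_natCast, inv_pow]
        field_simp
    _ ≤ _ := by gcongr; exact hpB k

/-! ### Coefficients and the maximal term -/

theorem prodCoeff_succ (h : ℂ → ℂ) (n : ℕ) :
    prodCoeff h (n + 1) = prodCoeff h n * h (n + 1) := by
  rw [prodCoeff, Finset.prod_range_succ, ← prodCoeff]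
  push_cast
  rfl

/-- A zero of `h` at a natural number would make all later coefficients vanish, and then (with
`log 0 = 0`) the left side below would grow like `n log n`. -/
theorem prodCoeff_ne_zero {h : ℂ → ℂ} {ρ c : ℝ} (hρ : 0 < ρ)
    (hc : (fun n : ℕ => -Real.log ‖prodCoeff h n‖ - (1 / ρ * n * Real.log n - c * n))
      =o[atTop] fun n : ℕ => (n : ℝ)) (n : ℕ) : prodCoeff h n ≠ 0 := by
  intro h0
  have hz : ∀ m, n ≤ m → prodCoeff h m = 0 := by
    intro m hm
    induction m, hm using Nat.le_induction with
    | base => exact h0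
    | succ m _ ih => rw [prodCoeff_succ, ih, zero_mul]
  have h1 := hc.bound one_pos
  have h2 : Tendsto (fun m : ℕ => Real.log m) atTop atTop :=
    Real.tendsto_log_atTop.comp tendsto_natCast_atTop_atTop
  obtain ⟨m, h3, h4, h5, h6⟩ := (h1.and ((h2.eventually_gt_atTop (ρ * (c + 1))).and
    ((eventually_ge_atTop n).and (eventually_gt_atTop 0)))).exists
  rw [hz m h5, norm_zero, Real.log_zero, neg_zero, zero_sub, norm_neg, Real.norm_natCast,
    one_mul] at h3
  have h7 := (le_abs_self _).trans h3
  have hm : (0 : ℝ) < m := by exact_mod_cast h6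
  have h8 : c + 1 < 1 / ρ * Real.log m := by
    rw [one_div, inv_mul_eq_div, lt_div_iff₀ hρ]
    linarith
  nlinarith

theorem exists_norm_prodCoeff_le {h : ℂ → ℂ} {ρ c : ℝ} (hρ : 0 < ρ)
    (hc : (fun n : ℕ => -Real.log ‖prodCoeff h n‖ - (1 / ρ * n * Real.log n - c * n))
      =o[atTop] fun n : ℕ => (n : ℝ)) {ε : ℝ} (hε : 0 < ε) :
    ∃ C, 0 < C ∧ ∀ n : ℕ,
      ‖prodCoeff h n‖ ≤ C * Real.exp ((c + ε) * n - 1 / ρ * n * Real.log n) := by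
  have h1 : (fun n => prodCoeff h n) =O[atTop]
      fun n : ℕ => Real.exp ((c + ε) * n - 1 / ρ * n * Real.log n) := by
    refine Asymptotics.IsBigO.of_bound 1 ?_
    filter_upwards [hc.bound hε] with n hn
    rw [Real.norm_natCast] at hn
    have hpos : 0 < ‖prodCoeff h n‖ := norm_pos_iff.2 (prodCoeff_ne_zero hρ hc n)
    rw [one_mul, Real.norm_of_nonneg (Real.exp_pos _).le, ← Real.exp_log hpos]
    refine Real.exp_le_exp.2 ?_
    have := (abs_le.1 hn).1
    linarith
  obtain ⟨C, hC, hb⟩ := Asymptotics.bound_of_isBigO_nat_atTop h1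
  refine ⟨C, hC, fun n => ?_⟩
  have := hb (x := n) (Real.exp_pos _).ne'
  rwa [Real.norm_of_nonneg (Real.exp_pos _).le] at this

/-- `x ↦ x (L - (log x) / ρ)` attains its maximum `exp (ρ L - 1) / ρ` at `x = exp (ρ L - 1)`. -/
theorem nat_mul_sub_log_le {ρ : ℝ} (hρ : 0 < ρ) (L : ℝ) (n : ℕ) :
    L * n - 1 / ρ * n * Real.log n ≤ Real.exp (ρ * L - 1) / ρ := by
  rcases Nat.eq_zero_or_pos n with rfl | hn
  · simp only [Nat.cast_zero, mul_zero, zero_mul, sub_zero]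
    positivity
  have hn' : (0 : ℝ) < n := by exact_mod_cast hn
  have h1 := Real.log_le_sub_one_of_pos (x := Real.exp (ρ * L - 1) / n) (by positivity)
  rw [Real.log_div (Real.exp_pos _).ne' hn'.ne', Real.log_exp] at h1
  have h2 : n * (ρ * L - 1 - Real.log n) ≤ Real.exp (ρ * L - 1) - n := by
    have := mul_le_mul_of_nonneg_left h1 hn'.le
    rwa [mul_sub_one, mul_div_cancel₀ _ hn'.ne'] at this
  rw [le_div_iff₀ hρ]
  have h3 : (L * n - 1 / ρ * n * Real.log n) * ρ = n * (ρ * L - Real.log n) := by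
    field_simp
  rw [h3]
  linarith

/-- The terms of the series are dominated by a geometric series times `exp (τ r ^ ρ)`, for every
`τ` above the type `exp (ρ c - 1) / ρ`. -/
theorem exists_norm_term_le {h : ℂ → ℂ} {ρ c : ℝ} (hρ : 0 < ρ)
    (hc : (fun n : ℕ => -Real.log ‖prodCoeff h n‖ - (1 / ρ * n * Real.log n - c * n))
      =o[atTop] fun n : ℕ => (n : ℝ)) {τ : ℝ} (hτ : Real.exp (ρ * c - 1) / ρ < τ) :
    ∃ C q, 0 < C ∧ 0 < q ∧ q < 1 ∧ ∀ (n : ℕ) (r : ℝ), 0 ≤ r →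
      ‖prodCoeff h n‖ * r ^ n ≤ C * Real.exp (τ * r ^ ρ) * q ^ n := by
  obtain ⟨ε, hε, hετ⟩ : ∃ ε : ℝ, 0 < ε ∧ Real.exp (ρ * (c + 2 * ε) - 1) / ρ < τ := by
    have hcont : ContinuousAt (fun ε : ℝ => Real.exp (ρ * (c + 2 * ε) - 1) / ρ) 0 := by fun_prop
    have h1 : ∀ᶠ ε in 𝓝 (0 : ℝ), Real.exp (ρ * (c + 2 * ε) - 1) / ρ < τ :=
      hcont.eventually_lt continuousAt_const (by simpa using hτ)
    obtain ⟨ε, h2, h3⟩ := ((h1.filter_mono nhdsWithin_le_nhds).and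
      (self_mem_nhdsWithin (s := Set.Ioi (0 : ℝ)))).exists
    exact ⟨ε, h3, h2⟩
  obtain ⟨C, hC, hb⟩ := exists_norm_prodCoeff_le hρ hc hε
  have hτ0 : 0 < τ := lt_trans (by positivity) hτ
  refine ⟨C, Real.exp (-ε), hC, Real.exp_pos _, by simpa using hε, fun n r hr => ?_⟩
  rcases hr.eq_or_lt with rfl | hr
  · rcases Nat.eq_zero_or_pos n with rfl | hn
    · have := hb 0
      simp only [Nat.cast_zero, mul_zero, zero_mul, sub_zero, Real.exp_zero] at this
      simpa [Real.zero_rpow hρ.ne'] using this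
    · rw [zero_pow hn.ne', mul_zero]
      positivity
  have h1 := nat_mul_sub_log_le hρ (Real.log r + c + 2 * ε) n
  have h2 : Real.exp (ρ * (Real.log r + c + 2 * ε) - 1) / ρ ≤ τ * r ^ ρ := by
    have : Real.exp (ρ * (Real.log r + c + 2 * ε) - 1) =
        Real.exp (ρ * (c + 2 * ε) - 1) * r ^ ρ := by
      rw [Real.rpow_def_of_pos hr, ← Real.exp_add]
      ring_nf
    rw [this, mul_div_right_comm]
    gcongr
  calc ‖prodCoeff h n‖ * r ^ n
      ≤ C * Real.exp ((c + ε) * n - 1 / ρ * n * Real.log n) * r ^ n := by gcongr; exact hb n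
    _ = C * Real.exp ((Real.log r + c + 2 * ε) * n - 1 / ρ * n * Real.log n) *
          Real.exp (-ε) ^ n := by
        have h3 : r ^ n = Real.exp (n * Real.log r) := by
          rw [Real.exp_nat_mul, Real.exp_log hr]
        rw [h3, ← Real.exp_nat_mul, mul_assoc C, mul_assoc C, ← Real.exp_add, ← Real.exp_add]
        ring_nf
    _ ≤ _ := by gcongr; exact h1.trans h2

/-- The maximal term is at least `exp (τ r ^ ρ)` for every `τ` below the type. -/
theorem eventually_exists_le_term {h : ℂ → ℂ} {ρ c : ℝ} (hρ : 0 < ρ)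
    (hc : (fun n : ℕ => -Real.log ‖prodCoeff h n‖ - (1 / ρ * n * Real.log n - c * n))
      =o[atTop] fun n : ℕ => (n : ℝ)) {τ : ℝ} (hτ : τ < Real.exp (ρ * c - 1) / ρ) :
    ∀ᶠ r : ℝ in atTop, ∃ n : ℕ, Real.exp (τ * r ^ ρ) ≤ ‖prodCoeff h n‖ * r ^ n := by
  -- The index `n = ⌊r ^ ρ exp (ρ c - 1)⌋` is that of the maximal term, up to rounding.
  set s : ℝ := Real.exp (ρ * c - 1) with hs
  have hs0 : 0 < s := Real.exp_pos _
  obtain ⟨ε, hε, hε1, hε2⟩ : ∃ ε : ℝ, 0 < ε ∧ 0 < 1 / ρ - ε ∧ τ < s * (1 / ρ - ε) := by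
    have h1 : ∀ᶠ ε in 𝓝 (0 : ℝ), τ < s * (1 / ρ - ε) :=
      ContinuousAt.eventually_lt continuousAt_const (by fun_prop)
        (by rw [sub_zero, mul_one_div]; exact hτ)
    have h2 : ∀ᶠ ε in 𝓝 (0 : ℝ), 0 < 1 / ρ - ε :=
      ContinuousAt.eventually_lt continuousAt_const (by fun_prop) (by simpa using hρ)
    obtain ⟨ε, ⟨h3, h4⟩, h5⟩ := (((h1.and h2).filter_mono nhdsWithin_le_nhds).and
      (self_mem_nhdsWithin (s := Set.Ioi (0 : ℝ)))).exists
    exact ⟨ε, h5, h4, h3⟩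
  have hpow := tendsto_rpow_atTop hρ
  have hfl : Tendsto (fun r : ℝ => ⌊r ^ ρ * s⌋₊) atTop atTop :=
    tendsto_nat_floor_atTop.comp (hpow.atTop_mul_const hs0)
  have hbig : Tendsto (fun r : ℝ => (s * (1 / ρ - ε) - τ) * r ^ ρ) atTop atTop :=
    hpow.const_mul_atTop (by linarith)
  filter_upwards [hfl.eventually (hc.bound hε), hfl.eventually_gt_atTop 0,
    hbig.eventually_ge_atTop (1 / ρ - ε), eventually_gt_atTop 0] with r h1 h2 h3 hr
  refine ⟨⌊r ^ ρ * s⌋₊, ?_⟩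
  set n := ⌊r ^ ρ * s⌋₊
  have hn : (0 : ℝ) < n := by exact_mod_cast h2
  have hrp : 0 < r ^ ρ := Real.rpow_pos_of_pos hr ρ
  have hle : (n : ℝ) ≤ r ^ ρ * s := Nat.floor_le (by positivity)
  have hge : r ^ ρ * s - 1 ≤ n := (Nat.sub_one_lt_floor _).le
  have hlog : Real.log n ≤ ρ * Real.log r + (ρ * c - 1) := by
    have := Real.log_le_log hn hle
    rwa [Real.log_mul hrp.ne' hs0.ne', Real.log_rpow hr, hs, Real.log_exp] at this
  rw [Real.norm_natCast] at h1
  have h4 := (abs_le.1 h1).2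
  have hpos : 0 < ‖prodCoeff h n‖ := norm_pos_iff.2 (prodCoeff_ne_zero hρ hc n)
  have h5 : r ^ n = Real.exp (n * Real.log r) := by rw [Real.exp_nat_mul, Real.exp_log hr]
  rw [h5, ← Real.exp_log hpos, ← Real.exp_add]
  refine Real.exp_le_exp.2 ?_
  have h6 : n * (1 / ρ * Real.log n) ≤ n * (Real.log r + c - 1 / ρ) := by
    refine mul_le_mul_of_nonneg_left ?_ hn.le
    rw [one_div, inv_mul_le_iff₀ hρ]
    have : ρ * (Real.log r + c - ρ⁻¹) = ρ * Real.log r + (ρ * c - 1) := by field_simp; ring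
    rw [this]
    exact hlog
  have h7 : (r ^ ρ * s - 1) * (1 / ρ - ε) ≤ n * (1 / ρ - ε) := by gcongr
  nlinarith

/-! ### The functional equation and propagation along an irrational rotation -/

/-- Since `(n + 1)² = n² + 2n + 1`, the series satisfies
`f z = c₀ + q z ∑ h (n + 1) a_n (q² z) ^ n` with `q = exp (2πiα)`, and the sum on the right is
controlled by `f` near `q² z`. -/
theorem exists_norm_le_of_shift {h : ℂ → ℂ} (hh : IsMinimalExponentialType h) {α : ℝ} {f : ℂ → ℂ}
    (hf : ∀ z : ℂ, HasSum (fun n : ℕ =>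
      prodCoeff h n * Complex.exp (2 * Real.pi * Complex.I * n ^ 2 * α) * z ^ n) (f z))
    {δ : ℝ} (hδ : 0 < δ) :
    ∃ C, 0 ≤ C ∧ ∀ (ζ : ℂ) (B : ℝ),
      (∀ w, ‖w - (ζ + (4 * Real.pi * α : ℝ) * Complex.I)‖ ≤ δ → ‖f (Complex.exp w)‖ ≤ B) →
      ‖f (Complex.exp ζ)‖ ≤ ‖prodCoeff h 0‖ + C * Real.exp ζ.re * B := by
  obtain ⟨b, hb, hbs⟩ := hh.exists_taylor
  refine ⟨∑' k, ‖b k‖ * k.factorial * δ⁻¹ ^ k, tsum_nonneg fun k => by positivity,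
    fun ζ B hB => ?_⟩
  have h1 := norm_tsum_multiplier_le hf hb hδ (hbs δ hδ) _ hB
  set η : ℂ := ζ + (4 * Real.pi * α : ℝ) * Complex.I with hη
  have h2 : f (Complex.exp ζ) = prodCoeff h 0 +
      Complex.exp (2 * Real.pi * Complex.I * α) * Complex.exp ζ * ∑' n : ℕ, h (n + 1) *
        (prodCoeff h n * Complex.exp (2 * Real.pi * Complex.I * n ^ 2 * α) *
          Complex.exp η ^ n) := by
    rw [← (hf (Complex.exp ζ)).tsum_eq, (hf (Complex.exp ζ)).summable.tsum_eq_zero_add,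
      ← tsum_mul_left]
    congr 1
    · simp
    · refine tsum_congr fun n => ?_
      have h3 : Complex.exp (2 * Real.pi * Complex.I * (n + 1 : ℕ) ^ 2 * α) *
          Complex.exp ζ ^ (n + 1) = Complex.exp (2 * Real.pi * Complex.I * α) * Complex.exp ζ *
          (Complex.exp (2 * Real.pi * Complex.I * n ^ 2 * α) * Complex.exp η ^ n) := by
        rw [← Complex.exp_nat_mul, ← Complex.exp_nat_mul, ← Complex.exp_add, ← Complex.exp_add,
          ← Complex.exp_add, ← Complex.exp_add, hη]
        congr 1
        push_cast
        ring
      rw [prodCoeff_succ, mul_assoc, h3]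
      ring
  rw [h2]
  refine (norm_add_le _ _).trans ?_
  gcongr
  have h4 : ‖Complex.exp (2 * Real.pi * Complex.I * α)‖ = 1 := by
    rw [Complex.norm_exp]
    simp
  rw [norm_mul, norm_mul, h4, one_mul, Complex.norm_exp ζ]
  linarith [mul_le_mul_of_nonneg_left h1 (Real.exp_pos ζ.re).le]

theorem eventually_add_mul_exp_lt {ρ : ℝ} (hρ : 0 < ρ) (K C : ℝ) {τ' τ : ℝ} (hτ' : 0 < τ')
    (hτ : τ' < τ) :
    ∀ᶠ t : ℝ in atTop, K + C * t * Real.exp (τ' * t ^ ρ) < Real.exp (τ * t ^ ρ) := by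
  have hpow := tendsto_rpow_atTop hρ
  have h1 : Tendsto (fun t : ℝ => Real.exp (τ * t ^ ρ)) atTop atTop :=
    Real.tendsto_exp_atTop.comp (hpow.const_mul_atTop (hτ'.trans hτ))
  -- `t exp (-(τ - τ') t ^ ρ) = s ^ (1 / ρ) exp (-(τ - τ') s) → 0` where `s = t ^ ρ`.
  have h2 : Tendsto (fun t : ℝ => C * (t * Real.exp (-(τ - τ') * t ^ ρ))) atTop (𝓝 (C * 0)) := by
    refine Tendsto.const_mul C ?_
    have h3 := (tendsto_rpow_mul_exp_neg_mul_atTop_nhds_zero (1 / ρ) (τ - τ')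
      (by linarith)).comp hpow
    refine h3.congr' ?_
    filter_upwards [eventually_ge_atTop 0] with t ht
    simp only [Function.comp]
    rw [← Real.rpow_mul ht, mul_one_div_cancel hρ.ne', Real.rpow_one]
  rw [mul_zero] at h2
  filter_upwards [h1.eventually_gt_atTop (2 * K),
    h2.eventually_lt_const (show (0 : ℝ) < 1 / 2 by norm_num)] with t h4 h5
  have h6 : C * t * Real.exp (τ' * t ^ ρ) =
      C * (t * Real.exp (-(τ - τ') * t ^ ρ)) * Real.exp (τ * t ^ ρ) := by
    rw [mul_assoc, mul_assoc C, mul_assoc t, ← Real.exp_add]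
    ring_nf
  rw [h6]
  nlinarith [Real.exp_pos (τ * t ^ ρ)]

/-- Iterating the one-step estimate: if `|f|` is large at `exp ζ`, it is almost as large near the
image of `exp ζ` under `N` rotations by the angle `β`. -/
theorem eventually_exists_large_near_shift {f : ℂ → ℂ} {ρ K β : ℝ} (hρ : 0 < ρ)
    (hstep : ∀ δ : ℝ, 0 < δ → ∃ C, 0 ≤ C ∧ ∀ (ζ : ℂ) (B : ℝ),
      (∀ w, ‖w - (ζ + β * Complex.I)‖ ≤ δ → ‖f (Complex.exp w)‖ ≤ B) →
      ‖f (Complex.exp ζ)‖ ≤ K + C * Real.exp ζ.re * B)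
    (N : ℕ) : ∀ {δ τ' τ : ℝ}, 0 < δ → 0 < τ' → τ' < τ →
      ∀ᶠ t : ℝ in atTop, ∀ ζ : ℂ, ζ.re + δ ≤ Real.log t + 1 →
        Real.exp (τ * t ^ ρ) ≤ ‖f (Complex.exp ζ)‖ →
        ∃ w, ‖w - (ζ + (N * β : ℝ) * Complex.I)‖ ≤ δ ∧
          Real.exp (τ' * t ^ ρ) ≤ ‖f (Complex.exp w)‖ := by
  induction N with
  | zero =>
    intro δ τ' τ hδ hτ' hτ
    filter_upwards [eventually_ge_atTop 0] with t ht ζ _ hζ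
    refine ⟨ζ, by simpa using hδ.le, le_trans (Real.exp_le_exp.2 ?_) hζ⟩
    exact mul_le_mul_of_nonneg_right hτ.le (Real.rpow_nonneg ht ρ)
  | succ N ih =>
    intro δ τ' τ hδ hτ' hτ
    obtain ⟨C, hC0, hC⟩ := hstep (δ / 2) (by positivity)
    filter_upwards [ih (δ := δ / 2) (τ' := (τ' + τ) / 2) (τ := τ) (by positivity) (by linarith)
      (by linarith), eventually_add_mul_exp_lt hρ K (C * Real.exp 1) hτ'
      (show τ' < (τ' + τ) / 2 by linarith), eventually_gt_atTop 0] with t h1 h2 ht ζ h3 h4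
    obtain ⟨w, hw1, hw2⟩ := h1 ζ (by linarith) h4
    have hre : w.re ≤ Real.log t + 1 := by
      have h5 := (Complex.abs_re_le_norm _).trans hw1
      simp only [Complex.sub_re, Complex.add_re, Complex.re_ofReal_mul, Complex.I_re, mul_zero,
        add_zero] at h5
      linarith [(abs_le.1 h5).2]
    by_contra! hcon
    refine absurd (hC w (Real.exp (τ' * t ^ ρ)) fun v hv => (hcon v ?_).le) ?_
    · have h6 : v - (ζ + ((N + 1 : ℕ) * β : ℝ) * Complex.I) = (v - (w + β * Complex.I)) +
          (w - (ζ + (N * β : ℝ) * Complex.I)) := by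
        push_cast
        ring
      rw [h6]
      linarith [norm_add_le (v - (w + β * Complex.I)) (w - (ζ + (N * β : ℝ) * Complex.I))]
    · rw [not_le]
      have h7 : Real.exp w.re ≤ t * Real.exp 1 := by
        have := Real.exp_le_exp.2 hre
        rwa [Real.exp_add, Real.exp_log ht] at this
      calc K + C * Real.exp w.re * Real.exp (τ' * t ^ ρ)
          ≤ K + C * (t * Real.exp 1) * Real.exp (τ' * t ^ ρ) := by gcongr
        _ = K + C * Real.exp 1 * t * Real.exp (τ' * t ^ ρ) := by ring
        _ < _ := h2
        _ ≤ _ := hw2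

/-- The forward orbit of an irrational rotation is uniformly dense: every real number is
approximated modulo `1` by one of the first `N₀` multiples of `x`. -/
theorem Irrational.exists_forall_exists_nat_mul_near {x : ℝ} (hx : Irrational x) {ε : ℝ}
    (hε : 0 < ε) :
    ∃ N₀ : ℕ, ∀ y : ℝ, ∃ N ≤ N₀, ∃ m : ℤ, |N * x - y - m| ≤ ε := by
  obtain ⟨n, hn⟩ := exists_nat_one_div_lt hε
  obtain ⟨k, hk0, -, hk⟩ := Real.exists_nat_abs_mul_sub_round_le x (Nat.succ_pos n)
  set d : ℝ := k * x - round (k * x) with hd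
  have hdε : |d| ≤ ε := by
    refine hk.trans (le_trans ?_ hn.le)
    push_cast
    gcongr
    linarith
  have hd0 : d ≠ 0 := by
    intro h0
    exact (hx.natCast_mul hk0.ne').ne_int (round (k * x)) (by linarith)
  have hdpos : 0 < |d| := abs_pos.2 hd0
  refine ⟨⌊1 / |d|⌋₊ * k, fun y => ?_⟩
  -- Representing `y` modulo `1` by `v` with the sign of `d`, take the multiple `⌊v / d⌋` of `d`.
  obtain ⟨v, l, hv, hv0, hv1⟩ : ∃ (v : ℝ) (l : ℤ), y = v + l ∧ 0 ≤ v / d ∧ v / d ≤ 1 / |d| := by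
    rcases hd0.lt_or_gt with h | h
    · refine ⟨Int.fract y - 1, ⌊y⌋ + 1, ?_, ?_, ?_⟩
      · push_cast
        linarith [Int.fract_add_floor y]
      · exact div_nonneg_of_nonpos (by linarith [Int.fract_lt_one y]) h.le
      · rw [abs_of_neg h, ← neg_div_neg_eq]
        have : 0 ≤ -d := by linarith
        gcongr
        linarith [Int.fract_nonneg y]
    · refine ⟨Int.fract y, ⌊y⌋, (Int.fract_add_floor y).symm, ?_, ?_⟩
      · exact div_nonneg (Int.fract_nonneg y) h.le
      · rw [abs_of_pos h]
        gcongr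
        exact (Int.fract_lt_one y).le
  set j := ⌊v / d⌋₊
  refine ⟨j * k, Nat.mul_le_mul_right k (Nat.floor_le_floor hv1), j * round (k * x) - l, ?_⟩
  have h1 : ((j * k : ℕ) : ℝ) * x - y - ((j * round (k * x) - l : ℤ) : ℝ) = d * (j - v / d) := by
    rw [hv, mul_sub, mul_div_cancel₀ _ hd0, hd]
    push_cast
    ring
  rw [h1, abs_mul]
  have h2 : |(j : ℝ) - v / d| ≤ 1 := by
    have h3 := Nat.floor_le hv0
    have h4 := (Nat.sub_one_lt_floor (v / d)).le
    rw [abs_le]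
    constructor <;> linarith
  nlinarith

/-- If on every large circle `|f|` is somewhere as large as `exp (τ t ^ ρ)`, then it is so near
every point of the circle. -/
theorem eventually_forall_exists_large {f : ℂ → ℂ} {ρ K x σ : ℝ} (hρ : 0 < ρ) (hσ : 0 < σ)
    (hx : Irrational x)
    (hstep : ∀ δ : ℝ, 0 < δ → ∃ C, 0 ≤ C ∧ ∀ (ζ : ℂ) (B : ℝ),
      (∀ w, ‖w - (ζ + (2 * Real.pi * x : ℝ) * Complex.I)‖ ≤ δ → ‖f (Complex.exp w)‖ ≤ B) →
      ‖f (Complex.exp ζ)‖ ≤ K + C * Real.exp ζ.re * B)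
    (hlow : ∀ τ < σ, ∀ᶠ t : ℝ in atTop, ∃ z, ‖z‖ = t ∧ Real.exp (τ * t ^ ρ) ≤ ‖f z‖)
    {ε τ : ℝ} (hε : 0 < ε) (hτ : τ < σ) :
    ∀ᶠ t : ℝ in atTop, ∀ θ : ℝ, ∃ w : ℂ, ‖w - (Real.log t + θ * Complex.I)‖ ≤ ε ∧
      Real.exp (τ * t ^ ρ) ≤ ‖f (Complex.exp w)‖ := by
  have hpi := Real.pi_pos
  -- It suffices to treat positive `τ`.
  obtain ⟨τ₁, h1, h2, h3⟩ : ∃ τ₁, 0 < τ₁ ∧ τ ≤ τ₁ ∧ τ₁ < σ :=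
    ⟨max τ (σ / 2), lt_max_of_lt_right (by linarith), le_max_left _ _,
      max_lt hτ (by linarith)⟩
  set δ : ℝ := min (ε / 2) 1 with hδ_def
  have hδ : 0 < δ := lt_min (by linarith) one_pos
  obtain ⟨N₀, hN₀⟩ := hx.exists_forall_exists_nat_mul_near (ε := ε / 2 / (2 * Real.pi))
    (by positivity)
  have hall : ∀ᶠ t : ℝ in atTop, ∀ N ∈ Finset.range (N₀ + 1), ∀ ζ : ℂ,
      ζ.re + δ ≤ Real.log t + 1 →
        Real.exp ((τ₁ + σ) / 2 * t ^ ρ) ≤ ‖f (Complex.exp ζ)‖ →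
        ∃ w, ‖w - (ζ + (N * (2 * Real.pi * x) : ℝ) * Complex.I)‖ ≤ δ ∧
          Real.exp (τ₁ * t ^ ρ) ≤ ‖f (Complex.exp w)‖ :=
    (Filter.eventually_all_finset _).2 fun N _ =>
      eventually_exists_large_near_shift hρ hstep N hδ h1 (by linarith)
  filter_upwards [hall, hlow ((τ₁ + σ) / 2) (by linarith), eventually_gt_atTop 0]
    with t h4 h5 ht θ
  obtain ⟨z, hz1, hz2⟩ := h5
  have hz0 : z ≠ 0 := norm_pos_iff.1 (hz1 ▸ ht)
  obtain ⟨N, hN, m, hm⟩ := hN₀ ((θ - z.arg) / (2 * Real.pi))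
  have hlogz : Complex.log z = Real.log t + z.arg * Complex.I := by
    rw [← hz1]
    exact Complex.ext (by simp [Complex.log_re]) (by simp [Complex.log_im])
  obtain ⟨w, hw1, hw2⟩ := h4 N (Finset.mem_range.2 (Nat.lt_succ_of_le hN)) (Complex.log z)
    (by rw [Complex.log_re, hz1]; linarith [min_le_right (ε / 2) (1 : ℝ)])
    (by rwa [Complex.exp_log hz0])
  refine ⟨w - m * (2 * Real.pi * Complex.I), ?_, ?_⟩
  · have h6 : w - m * (2 * Real.pi * Complex.I) - (Real.log t + θ * Complex.I) =
        (w - (Complex.log z + (N * (2 * Real.pi * x) : ℝ) * Complex.I)) +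
          ((2 * Real.pi * (N * x - (θ - z.arg) / (2 * Real.pi) - m) : ℝ) : ℂ) * Complex.I := by
      rw [hlogz]
      have : (Real.pi : ℂ) ≠ 0 := by exact_mod_cast hpi.ne'
      push_cast
      field_simp
      ring
    have h7 : ‖((2 * Real.pi * (N * x - (θ - z.arg) / (2 * Real.pi) - m) : ℝ) : ℂ) * Complex.I‖ ≤
        ε / 2 := by
      rw [norm_mul, Complex.norm_I, mul_one, Complex.norm_real, Real.norm_eq_abs, abs_mul,
        abs_of_pos (by positivity : 0 < 2 * Real.pi)]
      rwa [le_div_iff₀' (by positivity)] at hm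
    rw [h6]
    refine (norm_add_le _ _).trans ?_
    linarith [min_le_left (ε / 2) (1 : ℝ)]
  · rw [Complex.exp_periodic.sub_int_mul_eq]
    refine le_trans (Real.exp_le_exp.2 ?_) hw2
    exact mul_le_mul_of_nonneg_right h2 (Real.rpow_nonneg ht.le ρ)

/-- The series converges everywhere, and its sum has the growth `exp (σ r ^ ρ + o(r ^ ρ))` with
`σ = exp (ρ c - 1) / ρ`, as an upper bound everywhere and as a lower bound somewhere on each large
circle. -/
theorem exists_hasSum_series {h : ℂ → ℂ} {ρ c α : ℝ} (hρ : 0 < ρ)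
    (hc : (fun n : ℕ => -Real.log ‖prodCoeff h n‖ - (1 / ρ * n * Real.log n - c * n))
      =o[atTop] fun n : ℕ => (n : ℝ)) :
    ∃ f : ℂ → ℂ,
      (∀ z : ℂ, HasSum (fun n : ℕ =>
        prodCoeff h n * Complex.exp (2 * Real.pi * Complex.I * n ^ 2 * α) * z ^ n) (f z)) ∧
      (∀ τ, Real.exp (ρ * c - 1) / ρ < τ →
        ∃ C, ∀ z, ‖f z‖ ≤ C * Real.exp (τ * ‖z‖ ^ ρ)) ∧
      ∀ τ < Real.exp (ρ * c - 1) / ρ,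
        ∀ᶠ t : ℝ in atTop, ∃ z, ‖z‖ = t ∧ Real.exp (τ * t ^ ρ) ≤ ‖f z‖ := by
  have hq : ∀ n : ℕ, ‖Complex.exp (2 * Real.pi * Complex.I * n ^ 2 * α)‖ = 1 := fun n => by
    have : (2 * Real.pi * Complex.I * n ^ 2 * α : ℂ) =
        (2 * Real.pi * n ^ 2 * α : ℝ) * Complex.I := by push_cast; ring
    rw [this, Complex.norm_exp_ofReal_mul_I]
  set a : ℕ → ℂ := fun n =>
    prodCoeff h n * Complex.exp (2 * Real.pi * Complex.I * n ^ 2 * α) with ha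
  have hna : ∀ n, ‖a n‖ = ‖prodCoeff h n‖ := fun n => by rw [ha]; simp only [norm_mul, hq, mul_one]
  have hterm : ∀ τ, Real.exp (ρ * c - 1) / ρ < τ → ∃ C q, 0 < C ∧ 0 < q ∧ q < 1 ∧
      ∀ (n : ℕ) (z : ℂ), ‖a n * z ^ n‖ ≤ C * Real.exp (τ * ‖z‖ ^ ρ) * q ^ n := fun τ hτ => by
    obtain ⟨C, q, hC, hq0, hq1, hb⟩ := exists_norm_term_le hρ hc hτ
    refine ⟨C, q, hC, hq0, hq1, fun n z => ?_⟩
    rw [norm_mul, norm_pow, hna]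
    exact hb n _ (norm_nonneg z)
  have hf : ∀ z, HasSum (fun n => a n * z ^ n) (∑' n, a n * z ^ n) := fun z => by
    obtain ⟨C, q, -, hq0, hq1, hb⟩ := hterm _ (lt_add_one _)
    exact (Summable.of_norm_bounded ((summable_geometric_of_lt_one hq0.le hq1).mul_left _)
      fun n => hb n z).hasSum
  refine ⟨fun z => ∑' n, a n * z ^ n, hf, fun τ hτ => ?_, fun τ hτ => ?_⟩
  · obtain ⟨C, q, -, hq0, hq1, hb⟩ := hterm τ hτ
    refine ⟨C * (1 - q)⁻¹, fun z => ?_⟩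
    have := tsum_of_norm_bounded ((hasSum_geometric_of_lt_one hq0.le hq1).mul_left _)
      fun n => hb n z
    linarith
  · filter_upwards [eventually_exists_le_term hρ hc (τ := (τ + Real.exp (ρ * c - 1) / ρ) / 2)
      (by linarith), eventually_gt_atTop 0] with t ⟨n, hn⟩ ht
    by_contra! hcon
    have h1 := norm_coeff_mul_pow_le hf ht (fun z hz => (hcon z hz).le) n
    rw [hna] at h1
    have h2 : 0 < t ^ ρ := Real.rpow_pos_of_pos ht ρ
    have h3 := Real.exp_le_exp.1 (hn.trans h1)
    nlinarith

/-! ### Area means of `log |f|` -/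

/-- The super-mean value property of `A - log |f| ≥ 0` over a circle. The hypothesis `0 ≤ A` accounts
for the convention `log 0 = 0` at the zeros of `f`. -/
theorem lintegral_circle_sub_log_le {f : ℂ → ℂ} (hf : Differentiable ℂ f) {c : ℂ} {r A : ℝ}
    (hr : 0 < r) (hA : 0 ≤ A) (hc : f c ≠ 0)
    (hB : ∀ z ∈ Metric.closedBall c r, ‖f z‖ ≤ Real.exp A) :
    ∫⁻ θ in Set.Ioo (-Real.pi) Real.pi, ENNReal.ofReal (A - Real.log ‖f (circleMap c r θ)‖) ≤
      ENNReal.ofReal (2 * Real.pi * (A - Real.log ‖f c‖)) := by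
  have hpi := Real.pi_pos
  have han : AnalyticOnNhd ℂ f Set.univ := hf.differentiableOn.analyticOnNhd isOpen_univ
  have hle : ∀ z ∈ Metric.closedBall c r, Real.log ‖f z‖ ≤ A := fun z hz => by
    rcases (norm_nonneg (f z)).eq_or_lt with h | h
    · rw [← h, Real.log_zero]
      exact hA
    · exact (Real.log_le_iff_le_exp h).2 (hB z hz)
  set u : ℝ → ℝ := fun θ => Real.log ‖f (circleMap c r θ)‖ with hu
  have hper : Function.Periodic u (2 * Real.pi) := fun θ => by
    simp only [hu, periodic_circleMap c r θ]
  have hint0 : IntervalIntegrable u volume 0 (2 * Real.pi) :=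
    MeromorphicOn.circleIntegrable_log_norm (c := c) (R := r)
      (fun z _ => (han z trivial).meromorphicAt)
  have hint : IntervalIntegrable u volume (-Real.pi) Real.pi :=
    hper.intervalIntegrable₀ (by positivity) hint0 _ _
  have hav : ∫ θ in (-Real.pi)..Real.pi, u θ = 2 * Real.pi * Real.circleAverage
      (fun z => Real.log ‖f z‖) c r := by
    have h1 := hper.intervalIntegral_add_eq (-Real.pi) 0
    rw [zero_add, show -Real.pi + 2 * Real.pi = Real.pi by ring] at h1
    rw [h1, Real.circleAverage_def, smul_eq_mul, ← mul_assoc, mul_inv_cancel₀ (by positivity),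
      one_mul]
  -- Jensen's formula, where the contribution of the zeros is nonnegative.
  have hj : Real.log ‖f c‖ ≤ Real.circleAverage (fun z => Real.log ‖f z‖) c r := by
    rw [AnalyticOnNhd.circleAverage_log_norm hr.ne' (han.mono (Set.subset_univ _)) hc]
    refine le_add_of_nonneg_left (finsum_nonneg fun z => ?_)
    by_cases hz : z ∈ Metric.closedBall c |r|
    · refine mul_nonneg ?_ ?_
      · exact_mod_cast (MeromorphicOn.AnalyticOnNhd.divisor_nonneg
          (han.mono (Set.subset_univ (Metric.closedBall c |r|)))) z
      · rw [abs_of_pos hr, Metric.mem_closedBall, dist_comm, dist_eq_norm] at hz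
        rcases (norm_nonneg (c - z)).eq_or_lt with h | h
        · simp [← h]
        · refine Real.log_nonneg ?_
          rw [← div_eq_mul_inv, one_le_div h]
          exact hz
    · rw [Function.locallyFinsuppWithin.apply_eq_zero_of_notMem _ hz]
      simp
  have hnn : ∀ θ, 0 ≤ A - u θ := fun θ =>
    sub_nonneg.2 (hle _ (circleMap_mem_closedBall c hr.le θ))
  have hint2 : IntervalIntegrable (fun θ => A - u θ) volume (-Real.pi) Real.pi :=
    intervalIntegrable_const.sub hint
  have hint3 : IntegrableOn (fun θ => A - u θ) (Set.Ioc (-Real.pi) Real.pi) :=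
    (intervalIntegrable_iff_integrableOn_Ioc_of_le (by linarith)).1 hint2
  rw [← setLIntegral_congr Ioo_ae_eq_Ioc.symm,
    ← ofReal_integral_eq_lintegral_ofReal hint3 (ae_of_all _ hnn),
    ← intervalIntegral.integral_of_le (by linarith), intervalIntegral.integral_sub
      intervalIntegrable_const hint, hav]
  refine ENNReal.ofReal_le_ofReal ?_
  rw [intervalIntegral.integral_const, smul_eq_mul]
  nlinarith

/-- The super-mean value property of `A - log |f| ≥ 0` over a disc. -/
theorem lintegral_ball_sub_log_le {f : ℂ → ℂ} (hf : Differentiable ℂ f) {c : ℂ} {R A : ℝ}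
    (hR : 0 < R) (hA : 0 ≤ A) (hc : f c ≠ 0)
    (hB : ∀ z ∈ Metric.closedBall c R, ‖f z‖ ≤ Real.exp A) :
    ∫⁻ z in Metric.ball c R, ENNReal.ofReal (A - Real.log ‖f z‖) ≤
      ENNReal.ofReal (Real.pi * R ^ 2 * (A - Real.log ‖f c‖)) := by
  have hpi := Real.pi_pos
  set G : ℂ → ENNReal := fun z => ENNReal.ofReal (A - Real.log ‖f z‖) with hG
  have hGm : Measurable G := by
    have : Measurable f := hf.continuous.measurable
    fun_prop
  have hD : 0 ≤ A - Real.log ‖f c‖ := by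
    have := hB c (Metric.mem_closedBall_self hR.le)
    linarith [(Real.log_le_iff_le_exp (norm_pos_iff.2 hc)).2 this]
  set H : ℂ → ENNReal := fun w => (Metric.ball c R).indicator G (c + w) with hH
  have hHm : Measurable H := (hGm.indicator measurableSet_ball).comp (measurable_const_add c)
  have h1 : ∫⁻ z in Metric.ball c R, G z = ∫⁻ w, H w := by
    rw [← lintegral_indicator measurableSet_ball]
    exact (lintegral_add_left_eq_self _ c).symm
  rw [h1, ← Complex.lintegral_comp_polarCoord_symm]
  have hcm : ∀ p : ℝ × ℝ, c + Complex.polarCoord.symm p = circleMap c p.1 p.2 := fun p => by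
    rw [Complex.polarCoord_symm_apply, circleMap, Complex.exp_mul_I]
    push_cast
    rfl
  have hcont : Continuous fun p : ℝ × ℝ => circleMap c p.1 p.2 := by
    unfold circleMap
    fun_prop
  have hm : Measurable fun p : ℝ × ℝ => ENNReal.ofReal p.1 • H (Complex.polarCoord.symm p) := by
    simp only [hH, hcm, smul_eq_mul]
    exact (ENNReal.measurable_ofReal.comp measurable_fst).mul
      ((hGm.indicator measurableSet_ball).comp hcont.measurable)
  rw [polarCoord_target, Measure.volume_eq_prod, ← Measure.prod_restrict,
    lintegral_prod _ hm.aemeasurable]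
  have h2 : ∀ r ∈ Set.Ioi (0 : ℝ), ∫⁻ θ in Set.Ioo (-Real.pi) Real.pi,
      ENNReal.ofReal r • H (Complex.polarCoord.symm (r, θ)) ≤
      (Set.Ioc 0 R).indicator (fun r => ENNReal.ofReal r *
        ENNReal.ofReal (2 * Real.pi * (A - Real.log ‖f c‖))) r := by
    intro r hr
    have hr0 : 0 < r := hr
    simp only [hH, hcm, smul_eq_mul]
    by_cases hrR : r < R
    · rw [Set.indicator_of_mem (show r ∈ Set.Ioc 0 R from ⟨hr0, hrR.le⟩), lintegral_const_mul' _ _ ENNReal.ofReal_ne_top]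
      gcongr
      refine le_trans (lintegral_mono fun θ => Set.indicator_le_self _ _ _)
        (lintegral_circle_sub_log_le hf hr0 hA hc fun z hz =>
          hB z (Metric.closedBall_subset_closedBall hrR.le hz))
    · have h3 : ∀ θ, circleMap c r θ ∉ Metric.ball c R := fun θ h => by
        rw [Metric.mem_ball, dist_eq_norm, circleMap_sub_center, norm_circleMap_zero,
          abs_of_pos hr0] at h
        exact hrR h
      simp [Set.indicator_of_notMem (h3 _)]
  refine (setLIntegral_mono' measurableSet_Ioi h2).trans ?_
  refine (setLIntegral_le_lintegral _ _).trans ?_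
  rw [lintegral_indicator measurableSet_Ioc, lintegral_mul_const' _ _ ENNReal.ofReal_ne_top]
  have h4 : ∫⁻ r in Set.Ioc 0 R, ENNReal.ofReal r = ENNReal.ofReal (R ^ 2 / 2) := by
    rw [← ofReal_integral_eq_lintegral_ofReal, ← intervalIntegral.integral_of_le hR.le,
      integral_id]
    · simp
    · exact (continuous_id.integrableOn_Icc).mono_set Set.Ioc_subset_Icc_self
    · exact (ae_restrict_iff' measurableSet_Ioc).2 (ae_of_all _ fun r hr => hr.1.le)
  rw [h4, ← ENNReal.ofReal_mul (by positivity)]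
  refine ENNReal.ofReal_le_ofReal (le_of_eq ?_)
  ring

/-- `log |f|` is locally integrable for entire `f ≢ 0`: a large disc about a single point where `f` does
not vanish contains any given point. -/
theorem locallyIntegrable_log_norm_of_differentiable {f : ℂ → ℂ} (hf : Differentiable ℂ f)
    (h0 : ∃ z, f z ≠ 0) : LocallyIntegrable fun z => Real.log ‖f z‖ := by
  obtain ⟨c, hc⟩ := h0
  intro x
  set R : ℝ := ‖x - c‖ + 1 with hR
  have hR0 : 0 < R := by positivity
  obtain ⟨M, hM⟩ := (isCompact_closedBall c R).exists_bound_of_continuousOn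
    hf.continuous.continuousOn
  set A : ℝ := |M| with hA
  have hB : ∀ z ∈ Metric.closedBall c R, ‖f z‖ ≤ Real.exp A := fun z hz =>
    ((hM z hz).trans (le_abs_self M)).trans (by linarith [Real.add_one_le_exp A])
  have h1 := lintegral_ball_sub_log_le hf hR0 (abs_nonneg M) hc hB
  refine ⟨Metric.ball c R, Metric.isOpen_ball.mem_nhds ?_, ?_⟩
  · rw [Metric.mem_ball, dist_eq_norm, hR]
    linarith
  have hmeas : Measurable fun z => A - Real.log ‖f z‖ := by
    have : Measurable f := hf.continuous.measurable
    fun_prop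
  have h2 : IntegrableOn (fun z => A - Real.log ‖f z‖) (Metric.ball c R) := by
    refine ⟨hmeas.aestronglyMeasurable, ?_⟩
    rw [hasFiniteIntegral_iff_ofReal]
    · exact h1.trans_lt ENNReal.ofReal_lt_top
    · refine (ae_restrict_iff' measurableSet_ball).2 (ae_of_all _ fun z hz => ?_)
      rcases (norm_nonneg (f z)).eq_or_lt with h | h
      · simp [← h, hA]
      · exact sub_nonneg.2 ((Real.log_le_iff_le_exp h).2
          (hB z (Metric.ball_subset_closedBall hz)))
  have h3 : IntegrableOn (fun _ : ℂ => A) (Metric.ball c R) :=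
    integrableOn_const measure_ball_lt_top.ne
  have h4 := h3.sub h2
  refine h4.congr (ae_of_all _ fun z => ?_)
  simp

/-- If the integrals of `g` over all discs of radius `R` with centre in `B(0, K + R)` are at most
`M`, averaging over the centres bounds the integral of `g` over `B(0, K)`. -/
theorem lintegral_ball_mul_le_of_forall_ball {g : ℂ → ENNReal} (hg : Measurable g) {K R : ℝ}
    {M : ENNReal}
    (hM : ∀ c, ‖c‖ ≤ K + R → ∫⁻ z in Metric.ball c R, g z ≤ M) :
    (∫⁻ z in Metric.ball 0 K, g z) * volume (Metric.ball (0 : ℂ) R) ≤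
      M * volume (Metric.ball (0 : ℂ) (K + R)) := by
  set F : ℂ → ℂ → ENNReal := fun z c => {p : ℂ × ℂ | dist p.1 p.2 < R}.indicator
    (fun p => g p.1) (z, c) with hF
  have hmeas : Measurable (Function.uncurry F) := by
    have : MeasurableSet {p : ℂ × ℂ | dist p.1 p.2 < R} :=
      (isOpen_lt (by fun_prop) continuous_const).measurableSet
    exact (hg.comp measurable_fst).indicator this
  calc (∫⁻ z in Metric.ball 0 K, g z) * volume (Metric.ball (0 : ℂ) R)
      = ∫⁻ z in Metric.ball 0 K, g z * volume (Metric.ball (0 : ℂ) R) :=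
        (lintegral_mul_const _ hg).symm
    _ ≤ ∫⁻ z in Metric.ball 0 K, ∫⁻ c in Metric.ball 0 (K + R), F z c := by
        refine setLIntegral_mono' measurableSet_ball fun z hz => ?_
        have h1 : Metric.ball z R ⊆ Metric.ball 0 (K + R) :=
          Metric.ball_subset_ball' (by rw [Metric.mem_ball] at hz; linarith)
        calc g z * volume (Metric.ball (0 : ℂ) R) = ∫⁻ c in Metric.ball z R, g z := by
              rw [setLIntegral_const, Complex.volume_ball, Complex.volume_ball]
          _ ≤ ∫⁻ c in Metric.ball z R, F z c := by
              refine setLIntegral_mono' measurableSet_ball fun c hc => ?_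
              rw [Metric.mem_ball, dist_comm] at hc
              have hmem : (z, c) ∈ {p : ℂ × ℂ | dist p.1 p.2 < R} := hc
              exact (Set.indicator_of_mem hmem fun p => g p.1).ge
          _ ≤ _ := lintegral_mono_set h1
    _ = ∫⁻ c in Metric.ball 0 (K + R), ∫⁻ z in Metric.ball 0 K, F z c :=
        lintegral_lintegral_swap hmeas.aemeasurable
    _ ≤ ∫⁻ _ in Metric.ball (0 : ℂ) (K + R), M := by
        refine setLIntegral_mono' measurableSet_ball fun c hc => ?_
        refine le_trans ?_ (hM c (by simpa using (Metric.mem_ball.1 hc).le))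
        rw [← lintegral_indicator (s := Metric.ball c R) measurableSet_ball]
        exact (setLIntegral_le_lintegral _ _).trans (lintegral_mono fun z => le_of_eq rfl)
    _ = _ := setLIntegral_const _ _

/-! ### Completely regular growth -/

theorem eventually_forall_norm_le_exp {f : ℂ → ℂ} {ρ σ : ℝ} (hρ : 0 < ρ)
    (hU : ∀ τ, σ < τ → ∃ C, ∀ z, ‖f z‖ ≤ C * Real.exp (τ * ‖z‖ ^ ρ)) {K η : ℝ} (hK : 0 < K)
    (hη : 0 < η) :
    ∀ᶠ t : ℝ in atTop, ∀ z : ℂ, ‖z‖ ≤ K → ‖f (t * z)‖ ≤ Real.exp (t ^ ρ * (σ * ‖z‖ ^ ρ + η)) := by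
  have hKρ : 0 < K ^ ρ := Real.rpow_pos_of_pos hK ρ
  obtain ⟨C, hC⟩ := hU (σ + η / 2 / K ^ ρ) (by linarith [show 0 < η / 2 / K ^ ρ by positivity])
  have h1 : Tendsto (fun t : ℝ => η / 2 * t ^ ρ) atTop atTop :=
    (tendsto_rpow_atTop hρ).const_mul_atTop (by positivity)
  filter_upwards [(Real.tendsto_exp_atTop.comp h1).eventually_ge_atTop C,
    eventually_gt_atTop 0] with t h2 ht z hz
  have h3 := hC (t * z)
  rw [norm_mul, Complex.norm_real, Real.norm_of_nonneg ht.le,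
    Real.mul_rpow ht.le (norm_nonneg z)] at h3
  refine h3.trans ?_
  calc C * Real.exp ((σ + η / 2 / K ^ ρ) * (t ^ ρ * ‖z‖ ^ ρ))
      ≤ Real.exp (η / 2 * t ^ ρ) * Real.exp ((σ + η / 2 / K ^ ρ) * (t ^ ρ * ‖z‖ ^ ρ)) := by
        gcongr
        exact h2
    _ = Real.exp (t ^ ρ * (σ * ‖z‖ ^ ρ + η / 2 + η / 2 / K ^ ρ * ‖z‖ ^ ρ)) := by
        rw [← Real.exp_add]
        ring_nf
    _ ≤ _ := by
        have h4 : η / 2 / K ^ ρ * ‖z‖ ^ ρ ≤ η / 2 := by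
          rw [div_mul_eq_mul_div, div_le_iff₀ hKρ]
          gcongr
        refine Real.exp_le_exp.2 (mul_le_mul_of_nonneg_left ?_ (Real.rpow_nonneg ht.le ρ))
        linarith

/-- Rescaled form of `hL`: near every point `z₀` of a fixed disc, the centre included, there is a point
at which `t ^ (-ρ) log |f (t z)|` is at least `σ |z₀| ^ ρ - η`. -/
theorem eventually_forall_exists_near {f : ℂ → ℂ} {ρ σ : ℝ} (hρ : 0 < ρ) (hσ : 0 < σ)
    (hL : ∀ ε, 0 < ε → ∀ τ < σ, ∀ᶠ t : ℝ in atTop, ∀ θ : ℝ, ∃ w : ℂ,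
      ‖w - (Real.log t + θ * Complex.I)‖ ≤ ε ∧ Real.exp (τ * t ^ ρ) ≤ ‖f (Complex.exp w)‖)
    {K R η : ℝ} (hK : 0 < K) (hR : 0 < R) (hR1 : R ≤ 1) (hη : 0 < η) :
    ∀ᶠ t : ℝ in atTop, ∀ z₀ : ℂ, ‖z₀‖ ≤ K → ∃ z₁, ‖z₁ - z₀‖ ≤ R ∧
      Real.exp (t ^ ρ * (σ * ‖z₀‖ ^ ρ - η)) ≤ ‖f (t * z₁)‖ := by
  set ε : ℝ := min 1 (R / (4 * (K + 1))) with hε_def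
  have hε : 0 < ε := lt_min one_pos (by positivity)
  have hK1 : 0 < (K + 1) ^ ρ := Real.rpow_pos_of_pos (by linarith) ρ
  obtain ⟨T, hT⟩ := eventually_atTop.1 (hL ε hε (σ - η / (K + 1) ^ ρ)
    (by linarith [show 0 < η / (K + 1) ^ ρ by positivity]))
  filter_upwards [eventually_ge_atTop (T / (R / 4)), eventually_gt_atTop 0] with t hTt ht z₀ hz₀
  -- A point close to the origin is first moved to the circle of radius `R / 4`.
  obtain ⟨z, hzz, hzR, hzK, hz0⟩ : ∃ z : ℂ, ‖z - z₀‖ ≤ R / 2 ∧ R / 4 ≤ ‖z‖ ∧ ‖z‖ ≤ K + 1 ∧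
      ‖z₀‖ ≤ ‖z‖ := by
    rcases le_or_gt (R / 4) ‖z₀‖ with h | h
    · exact ⟨z₀, by rw [sub_self, norm_zero]; positivity, h, by linarith, le_rfl⟩
    · have h1 : ‖((R / 4 : ℝ) : ℂ)‖ = R / 4 := by
        rw [Complex.norm_real, Real.norm_of_nonneg (by positivity)]
      refine ⟨((R / 4 : ℝ) : ℂ), ?_, h1.ge, by rw [h1]; linarith, by rw [h1]; exact h.le⟩
      have := norm_sub_le ((R / 4 : ℝ) : ℂ) z₀
      rw [h1] at this
      linarith
  have hzpos : 0 < ‖z‖ := lt_of_lt_of_le (by positivity) hzR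
  have hz1 : z ≠ 0 := norm_pos_iff.1 hzpos
  have htz : T ≤ t * ‖z‖ := by
    rw [div_le_iff₀ (by positivity)] at hTt
    exact hTt.trans (by gcongr)
  obtain ⟨w, hw1, hw2⟩ := hT _ htz z.arg
  set u : ℂ := w - (Real.log (t * ‖z‖) + z.arg * Complex.I) with hu
  have hexp : Complex.exp w = t * (z * Complex.exp u) := by
    have h2 : w = Real.log t + Complex.log z + u := by
      rw [hu, Real.log_mul ht.ne' hzpos.ne', Complex.log]
      push_cast
      ring
    rw [h2, Complex.exp_add, Complex.exp_add, Complex.exp_log hz1, ← Complex.ofReal_exp,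
      Real.exp_log ht, mul_assoc]
  refine ⟨z * Complex.exp u, ?_, ?_⟩
  · have h3 : ‖Complex.exp u - 1‖ ≤ 2 * ‖u‖ :=
      Complex.norm_exp_sub_one_le (hw1.trans (min_le_left _ _))
    have h4 : ‖u‖ ≤ R / (4 * (K + 1)) := hw1.trans (min_le_right _ _)
    have h5 : ‖z * Complex.exp u - z‖ ≤ R / 2 := by
      rw [show z * Complex.exp u - z = z * (Complex.exp u - 1) by ring, norm_mul]
      calc ‖z‖ * ‖Complex.exp u - 1‖ ≤ (K + 1) * (2 * (R / (4 * (K + 1)))) := by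
            gcongr
            exact h3.trans (by gcongr)
        _ = R / 2 := by field_simp; norm_num
    rw [show z * Complex.exp u - z₀ = (z * Complex.exp u - z) + (z - z₀) by ring]
    linarith [norm_add_le (z * Complex.exp u - z) (z - z₀)]
  · rw [← hexp]
    refine le_trans (Real.exp_le_exp.2 ?_) hw2
    rw [Real.mul_rpow ht.le hzpos.le]
    have h6 : η / (K + 1) ^ ρ * ‖z‖ ^ ρ ≤ η := by
      rw [div_mul_eq_mul_div, div_le_iff₀ hK1]
      gcongr
    have h7 : ‖z₀‖ ^ ρ ≤ ‖z‖ ^ ρ := by gcongr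
    have h8 : σ * ‖z₀‖ ^ ρ - η ≤ (σ - η / (K + 1) ^ ρ) * ‖z‖ ^ ρ := by nlinarith
    have h9 : 0 ≤ t ^ ρ := Real.rpow_nonneg ht.le ρ
    nlinarith

/-- On discs of a suitable small radius `R` the mean distance between `t ^ (-ρ) log |f (t z)|` and
`σ |z| ^ ρ` is at most `ε`: apply the super-mean value property on the disc of radius `2R` about a point
where `|f (t z)|` is large. -/
theorem exists_forall_ball_lintegral_le {f : ℂ → ℂ} (hf : Differentiable ℂ f) {ρ σ : ℝ}
    (hρ : 0 < ρ) (hσ : 0 < σ)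
    (hU : ∀ τ, σ < τ → ∃ C, ∀ z, ‖f z‖ ≤ C * Real.exp (τ * ‖z‖ ^ ρ))
    (hL : ∀ ε, 0 < ε → ∀ τ < σ, ∀ᶠ t : ℝ in atTop, ∀ θ : ℝ, ∃ w : ℂ,
      ‖w - (Real.log t + θ * Complex.I)‖ ≤ ε ∧ Real.exp (τ * t ^ ρ) ≤ ‖f (Complex.exp w)‖)
    {K ε : ℝ} (hK : 0 < K) (hε : 0 < ε) :
    ∃ R, 0 < R ∧ R ≤ 1 ∧ ∀ᶠ t : ℝ in atTop, ∀ z₀ : ℂ, ‖z₀‖ ≤ K →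
      ∫⁻ z in Metric.ball z₀ R,
        ENNReal.ofReal |t ^ (-ρ) * Real.log ‖f (t * z)‖ - σ * ‖z‖ ^ ρ| ≤
      ENNReal.ofReal (ε * (Real.pi * R ^ 2)) := by
  have hpi := Real.pi_pos
  set η : ℝ := ε / 14 with hη_def
  have hη : 0 < η := by positivity
  obtain ⟨R, hR0, hR1, hR⟩ : ∃ R, 0 < R ∧ R ≤ 1 ∧ ∀ x y : ℝ, 0 ≤ x → x ≤ K + 4 → 0 ≤ y →
      y ≤ K + 4 → |x - y| ≤ 4 * R → σ * x ^ ρ - σ * y ^ ρ ≤ η := by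
    have hc : UniformContinuousOn (fun x : ℝ => σ * x ^ ρ) (Set.Icc 0 (K + 4)) :=
      isCompact_Icc.uniformContinuousOn_of_continuous
        ((continuous_const.mul (Real.continuous_rpow_const hρ.le)).continuousOn)
    obtain ⟨d, hd, h⟩ := Metric.uniformContinuousOn_iff.1 hc η hη
    refine ⟨min 1 (d / 5), lt_min one_pos (by positivity), min_le_left _ _,
      fun x y hx hx' hy hy' hxy => ?_⟩
    have h1 := h x ⟨hx, hx'⟩ y ⟨hy, hy'⟩ (by
      rw [Real.dist_eq]
      linarith [min_le_right 1 (d / 5)])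
    rw [Real.dist_eq] at h1
    exact (le_abs_self _).trans h1.le
  refine ⟨R, hR0, hR1, ?_⟩
  filter_upwards [eventually_forall_norm_le_exp hρ hU (K := K + 4) (by linarith) hη,
    eventually_forall_exists_near hρ hσ hL hK hR0 hR1 hη, eventually_gt_atTop 0]
    with t hup hlow ht z₀ hz₀
  obtain ⟨z₁, hz1, hz1'⟩ := hlow z₀ hz₀
  have htρ : 0 < t ^ ρ := Real.rpow_pos_of_pos ht ρ
  have hinv : t ^ (-ρ) * t ^ ρ = 1 := by rw [Real.rpow_neg ht.le, inv_mul_cancel₀ htρ.ne']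
  have htn : 0 < t ^ (-ρ) := Real.rpow_pos_of_pos ht _
  set A : ℝ := σ * (‖z₀‖ + 3 * R) ^ ρ + η with hA_def
  have hA0 : 0 ≤ A := by positivity
  have hnear : ∀ z, ‖z - z₀‖ ≤ 3 * R → ‖z‖ ≤ ‖z₀‖ + 3 * R := fun z hz => by
    have := norm_add_le (z - z₀) z₀
    rw [sub_add_cancel] at this
    linarith
  have hbound : ∀ z, ‖z - z₀‖ ≤ 3 * R → ‖f (t * z)‖ ≤ Real.exp (t ^ ρ * A) := fun z hz => by
    have h1 := hnear z hz
    refine (hup z (by linarith)).trans (Real.exp_le_exp.2 ?_)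
    rw [hA_def]
    gcongr
  have hg : Differentiable ℂ fun z : ℂ => f (t * z) := hf.comp (by fun_prop)
  have hz1ne : f (t * z₁) ≠ 0 := norm_pos_iff.1 ((Real.exp_pos _).trans_le hz1')
  have hJ := lintegral_ball_sub_log_le hg (c := z₁) (R := 2 * R) (A := t ^ ρ * A) (by positivity)
    (by positivity) hz1ne fun z hz => hbound z (by
      rw [Metric.mem_closedBall, dist_eq_norm] at hz
      have := norm_add_le (z - z₁) (z₁ - z₀)
      rw [sub_add_sub_cancel] at this
      linarith)
  have hlog1 : t ^ ρ * (σ * ‖z₀‖ ^ ρ - η) ≤ Real.log ‖f (t * z₁)‖ :=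
    (Real.le_log_iff_exp_le (norm_pos_iff.2 hz1ne)).2 hz1'
  have hA1 : A - σ * ‖z₀‖ ^ ρ ≤ 2 * η := by
    have := hR (‖z₀‖ + 3 * R) ‖z₀‖ (by positivity) (by linarith) (norm_nonneg _) (by linarith)
      (by rw [add_sub_cancel_left, abs_of_pos (by positivity)]; linarith)
    linarith
  have hsub : Metric.ball z₀ R ⊆ Metric.ball z₁ (2 * R) :=
    Metric.ball_subset_ball' (by rw [dist_comm, dist_eq_norm]; linarith)
  have hpt : ∀ z ∈ Metric.ball z₀ R,
      ENNReal.ofReal |t ^ (-ρ) * Real.log ‖f (t * z)‖ - σ * ‖z‖ ^ ρ| ≤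
        ENNReal.ofReal (t ^ (-ρ)) * ENNReal.ofReal (t ^ ρ * A - Real.log ‖f (t * z)‖) +
          ENNReal.ofReal (2 * η) := by
    intro z hz
    rw [Metric.mem_ball, dist_eq_norm] at hz
    have h1 := hnear z (by linarith)
    have h2 : ‖z₀‖ - R ≤ ‖z‖ := by
      have := norm_sub_norm_le z₀ z
      rw [norm_sub_rev] at this
      linarith
    have h3 : Real.log ‖f (t * z)‖ ≤ t ^ ρ * A := by
      rcases (norm_nonneg (f (t * z))).eq_or_lt with h | h
      · rw [← h, Real.log_zero]
        positivity
      · exact (Real.log_le_iff_le_exp h).2 (hbound z (by linarith))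
    have h4 : A - σ * ‖z‖ ^ ρ ≤ 2 * η := by
      have := hR (‖z₀‖ + 3 * R) ‖z‖ (by positivity) (by linarith) (norm_nonneg _) (by linarith)
        (by rw [abs_of_nonneg] <;> linarith)
      linarith
    have h5 : σ * ‖z‖ ^ ρ ≤ A := by
      have : σ * ‖z‖ ^ ρ ≤ σ * (‖z₀‖ + 3 * R) ^ ρ := by gcongr
      linarith
    rw [← ENNReal.ofReal_mul htn.le, ← ENNReal.ofReal_add
      (mul_nonneg htn.le (by linarith)) (by positivity)]
    refine ENNReal.ofReal_le_ofReal ?_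
    have h6 : t ^ (-ρ) * (t ^ ρ * A - Real.log ‖f (t * z)‖) =
        A - t ^ (-ρ) * Real.log ‖f (t * z)‖ := by
      rw [mul_sub, ← mul_assoc, hinv, one_mul]
    have h7 : 0 ≤ t ^ (-ρ) * (t ^ ρ * A - Real.log ‖f (t * z)‖) :=
      mul_nonneg htn.le (by linarith)
    rw [h6] at h7 ⊢
    rw [abs_le]
    constructor <;> linarith
  have hvol : volume (Metric.ball z₀ R) = ENNReal.ofReal (Real.pi * R ^ 2) := by
    rw [Complex.volume_ball, ← ENNReal.ofReal_pow hR0.le, mul_comm Real.pi,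
      ENNReal.ofReal_mul (by positivity), ← NNReal.coe_real_pi, ENNReal.ofReal_coe_nnreal]
  calc ∫⁻ z in Metric.ball z₀ R,
        ENNReal.ofReal |t ^ (-ρ) * Real.log ‖f (t * z)‖ - σ * ‖z‖ ^ ρ|
      ≤ ∫⁻ z in Metric.ball z₀ R,
        (ENNReal.ofReal (t ^ (-ρ)) * ENNReal.ofReal (t ^ ρ * A - Real.log ‖f (t * z)‖) +
          ENNReal.ofReal (2 * η)) := setLIntegral_mono' measurableSet_ball hpt
    _ = ENNReal.ofReal (t ^ (-ρ)) *
          (∫⁻ z in Metric.ball z₀ R, ENNReal.ofReal (t ^ ρ * A - Real.log ‖f (t * z)‖)) +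
          ENNReal.ofReal (2 * η) * ENNReal.ofReal (Real.pi * R ^ 2) := by
        rw [lintegral_add_right _ measurable_const, setLIntegral_const, hvol,
          lintegral_const_mul' _ _ ENNReal.ofReal_ne_top]
    _ ≤ ENNReal.ofReal (t ^ (-ρ)) *
          ENNReal.ofReal (Real.pi * (2 * R) ^ 2 * (t ^ ρ * (3 * η))) +
          ENNReal.ofReal (2 * η) * ENNReal.ofReal (Real.pi * R ^ 2) := by
        gcongr
        refine ((lintegral_mono_set hsub).trans hJ).trans (ENNReal.ofReal_le_ofReal ?_)
        gcongr
        nlinarith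
    _ = ENNReal.ofReal (ε * (Real.pi * R ^ 2)) := by
        rw [← ENNReal.ofReal_mul htn.le, ← ENNReal.ofReal_mul (by positivity),
          ← ENNReal.ofReal_add (by positivity) (by positivity)]
        congr 1
        have h8 : t ^ (-ρ) * (Real.pi * (2 * R) ^ 2 * (t ^ ρ * (3 * η))) =
            (t ^ (-ρ) * t ^ ρ) * (Real.pi * (2 * R) ^ 2 * (3 * η)) := by ring
        rw [h8, hinv, hη_def]
        ring

/-- Convergence of `t ^ (-ρ) log |f (t z)|` to `σ |z| ^ ρ` in `L¹` on every disc. -/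
theorem eventually_lintegral_abs_sub_le {f : ℂ → ℂ} (hf : Differentiable ℂ f) {ρ σ : ℝ}
    (hρ : 0 < ρ) (hσ : 0 < σ)
    (hU : ∀ τ, σ < τ → ∃ C, ∀ z, ‖f z‖ ≤ C * Real.exp (τ * ‖z‖ ^ ρ))
    (hL : ∀ ε, 0 < ε → ∀ τ < σ, ∀ᶠ t : ℝ in atTop, ∀ θ : ℝ, ∃ w : ℂ,
      ‖w - (Real.log t + θ * Complex.I)‖ ≤ ε ∧ Real.exp (τ * t ^ ρ) ≤ ‖f (Complex.exp w)‖)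
    {K : ℝ} (hK : 0 < K) {ε : ℝ} (hε : 0 < ε) :
    ∀ᶠ t : ℝ in atTop, ∫⁻ z in Metric.ball 0 K,
      ENNReal.ofReal |t ^ (-ρ) * Real.log ‖f (t * z)‖ - σ * ‖z‖ ^ ρ| ≤ ENNReal.ofReal ε := by
  have hpi := Real.pi_pos
  obtain ⟨R, hR0, hR1, h⟩ := exists_forall_ball_lintegral_le hf hρ hσ hU hL (K := K + 1)
    (ε := ε / (Real.pi * (K + 1) ^ 2)) (by linarith) (by positivity)
  filter_upwards [h] with t ht
  have hmeas : Measurable fun z : ℂ =>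
      ENNReal.ofReal |t ^ (-ρ) * Real.log ‖f (t * z)‖ - σ * ‖z‖ ^ ρ| := by
    have : Measurable f := hf.continuous.measurable
    have h2 : Continuous fun z : ℂ => σ * ‖z‖ ^ ρ :=
      continuous_const.mul (continuous_norm.rpow_const fun _ => Or.inr hρ.le)
    have h3 : Measurable fun z : ℂ => σ * ‖z‖ ^ ρ := h2.measurable
    fun_prop
  have hvol : ∀ r : ℝ, 0 ≤ r →
      volume (Metric.ball (0 : ℂ) r) = ENNReal.ofReal (Real.pi * r ^ 2) := fun r hr => by
    rw [Complex.volume_ball, ← ENNReal.ofReal_pow hr, mul_comm Real.pi,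
      ENNReal.ofReal_mul (by positivity), ← NNReal.coe_real_pi, ENNReal.ofReal_coe_nnreal]
  have h1 := lintegral_ball_mul_le_of_forall_ball hmeas (K := K) (R := R)
    fun c hc => ht c (by linarith)
  rw [hvol R hR0.le, hvol _ (by linarith), ← ENNReal.ofReal_mul (by positivity)] at h1
  have h2 : ε / (Real.pi * (K + 1) ^ 2) * (Real.pi * R ^ 2) * (Real.pi * (K + R) ^ 2) ≤
      ε * (Real.pi * R ^ 2) := by
    have h3 : (K + R) ^ 2 ≤ (K + 1) ^ 2 := by gcongr
    calc ε / (Real.pi * (K + 1) ^ 2) * (Real.pi * R ^ 2) * (Real.pi * (K + R) ^ 2)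
        ≤ ε / (Real.pi * (K + 1) ^ 2) * (Real.pi * R ^ 2) * (Real.pi * (K + 1) ^ 2) := by gcongr
      _ = ε * (Real.pi * R ^ 2) := by field_simp
  have h4 := h1.trans (ENNReal.ofReal_le_ofReal h2)
  rw [ENNReal.ofReal_mul hε.le] at h4
  exact (ENNReal.mul_le_mul_iff_left (by simpa using (by positivity : 0 < Real.pi * R ^ 2))
    ENNReal.ofReal_ne_top).1 h4

theorem hasCompletelyRegularGrowth_of_bounds {f : ℂ → ℂ} (hf : Differentiable ℂ f) {ρ σ : ℝ}
    (hρ : 0 < ρ) (hσ : 0 < σ)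
    (hU : ∀ τ, σ < τ → ∃ C, ∀ z, ‖f z‖ ≤ C * Real.exp (τ * ‖z‖ ^ ρ))
    (hL : ∀ ε, 0 < ε → ∀ τ < σ, ∀ᶠ t : ℝ in atTop, ∀ θ : ℝ, ∃ w : ℂ,
      ‖w - (Real.log t + θ * Complex.I)‖ ≤ ε ∧ Real.exp (τ * t ^ ρ) ≤ ‖f (Complex.exp w)‖) :
    HasCompletelyRegularGrowth ρ f := by
  have hne : ∃ z, f z ≠ 0 := by
    obtain ⟨t, ht⟩ := (hL 1 one_pos 0 hσ).exists
    obtain ⟨w, -, hw⟩ := ht 0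
    exact ⟨_, norm_pos_iff.1 ((Real.exp_pos _).trans_le hw)⟩
  have hu : Continuous fun z : ℂ => σ * ‖z‖ ^ ρ :=
    continuous_const.mul (continuous_norm.rpow_const fun _ => Or.inr hρ.le)
  refine ⟨locallyIntegrable_log_norm_of_differentiable hf hne, fun z => σ * ‖z‖ ^ ρ,
    hu.locallyIntegrable, fun φ hφ hφc => ?_⟩
  obtain ⟨M, hM⟩ := hφc.exists_bound_of_continuous hφ.continuous
  obtain ⟨K, hK0, hK⟩ : ∃ K, 0 < K ∧ tsupport φ ⊆ Metric.ball 0 K := by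
    obtain ⟨K, hK⟩ := hφc.isCompact.isBounded.subset_ball 0
    exact ⟨max K 1, lt_max_of_lt_right one_pos,
      hK.trans (Metric.ball_subset_ball (le_max_left _ _))⟩
  rw [Metric.tendsto_nhds]
  intro ε hε
  have hM0 : 0 ≤ M := (norm_nonneg _).trans (hM 0)
  filter_upwards [eventually_lintegral_abs_sub_le hf hρ hσ hU hL hK0
    (ε := ε / (2 * (M + 1))) (by positivity), eventually_gt_atTop 0] with t h1 ht
  have hg : Differentiable ℂ fun z : ℂ => f (t * z) := hf.comp (by fun_prop)
  have hgne : ∃ z : ℂ, f (t * z) ≠ 0 := by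
    obtain ⟨z, hz⟩ := hne
    refine ⟨z / t, ?_⟩
    rwa [mul_div_cancel₀]
    exact_mod_cast ht.ne'
  have hvint : Integrable fun z : ℂ => t ^ (-ρ) * Real.log ‖f (t * z)‖ * φ z := by
    have h2 := (locallyIntegrable_log_norm_of_differentiable hg hgne).integrable_smul_left_of_hasCompactSupport
      hφ.continuous hφc
    refine (h2.const_mul (t ^ (-ρ))).congr (ae_of_all _ fun z => ?_)
    simp only [smul_eq_mul]
    ring
  have huint : Integrable fun z : ℂ => σ * ‖z‖ ^ ρ * φ z :=
    (hu.mul hφ.continuous).integrable_of_hasCompactSupport hφc.mul_left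
  rw [dist_eq_norm, ← integral_sub hvint huint]
  have h3 : ∫⁻ z : ℂ, ENNReal.ofReal ‖t ^ (-ρ) * Real.log ‖f (t * z)‖ * φ z -
      σ * ‖z‖ ^ ρ * φ z‖ ≤ ENNReal.ofReal (ε / 2) := by
    calc ∫⁻ z : ℂ, ENNReal.ofReal ‖t ^ (-ρ) * Real.log ‖f (t * z)‖ * φ z - σ * ‖z‖ ^ ρ * φ z‖
        ≤ ∫⁻ z : ℂ, (Metric.ball 0 K).indicator (fun z => ENNReal.ofReal M *
            ENNReal.ofReal |t ^ (-ρ) * Real.log ‖f (t * z)‖ - σ * ‖z‖ ^ ρ|) z := by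
          refine lintegral_mono fun z => ?_
          by_cases hz : z ∈ Metric.ball 0 K
          · rw [Set.indicator_of_mem hz, ← ENNReal.ofReal_mul hM0, ← sub_mul, norm_mul, mul_comm,
              Real.norm_eq_abs (_ - _)]
            exact ENNReal.ofReal_le_ofReal (by gcongr; exact hM z)
          · rw [image_eq_zero_of_notMem_tsupport fun h => hz (hK h)]
            simp
      _ = ENNReal.ofReal M * ∫⁻ z in Metric.ball 0 K,
            ENNReal.ofReal |t ^ (-ρ) * Real.log ‖f (t * z)‖ - σ * ‖z‖ ^ ρ| := by
          rw [lintegral_indicator measurableSet_ball, lintegral_const_mul' _ _ ENNReal.ofReal_ne_top]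
      _ ≤ ENNReal.ofReal M * ENNReal.ofReal (ε / (2 * (M + 1))) := by gcongr
      _ ≤ ENNReal.ofReal (ε / 2) := by
          rw [← ENNReal.ofReal_mul hM0]
          refine ENNReal.ofReal_le_ofReal ?_
          rw [mul_div_assoc', div_le_div_iff₀ (by positivity) (by positivity)]
          nlinarith
  have h4 := norm_integral_le_lintegral_norm (μ := volume) fun z : ℂ =>
    t ^ (-ρ) * Real.log ‖f (t * z)‖ * φ z - σ * ‖z‖ ^ ρ * φ z
  have h5 := ENNReal.toReal_mono ENNReal.ofReal_ne_top h3
  rw [ENNReal.toReal_ofReal (by positivity)] at h5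
  linarith

/-! ### Order and type -/

theorem norm_le_maxModulus {f : ℂ → ℂ} (hf : Continuous f) (z : ℂ) :
    ‖f z‖ ≤ maxModulus f ‖z‖ := by
  obtain ⟨M, hM⟩ := (isCompact_sphere (0 : ℂ) ‖z‖).exists_bound_of_continuousOn hf.continuousOn
  have hbdd : BddAbove (Set.range fun w : Metric.sphere (0 : ℂ) ‖z‖ => ‖f w‖) :=
    ⟨M, by rintro _ ⟨w, rfl⟩; exact hM w w.2⟩
  exact le_ciSup hbdd ⟨z, by simp⟩

theorem maxModulus_le {f : ℂ → ℂ} {r B : ℝ} (hr : 0 ≤ r) (hB : ∀ z, ‖z‖ = r → ‖f z‖ ≤ B) :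
    maxModulus f r ≤ B := by
  have : Nonempty (Metric.sphere (0 : ℂ) r) := (NormedSpace.sphere_nonempty.2 hr).to_subtype
  exact ciSup_le fun w => hB w (by simp)

theorem tendsto_log_maxModulus_div {f : ℂ → ℂ} (hf : Continuous f) {ρ σ : ℝ}
    (hρ : 0 < ρ)
    (hU : ∀ τ, σ < τ → ∃ C, ∀ z, ‖f z‖ ≤ C * Real.exp (τ * ‖z‖ ^ ρ))
    (hlow : ∀ τ < σ, ∀ᶠ t : ℝ in atTop, ∃ z, ‖z‖ = t ∧ Real.exp (τ * t ^ ρ) ≤ ‖f z‖) :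
    Tendsto (fun r => Real.log (maxModulus f r) / r ^ ρ) atTop (𝓝 σ) := by
  rw [Metric.tendsto_nhds]
  intro ε hε
  filter_upwards [eventually_forall_norm_le_exp hρ hU one_pos (half_pos hε),
    hlow (σ - ε / 2) (by linarith), eventually_gt_atTop 0] with t h1 ⟨z, hz1, hz2⟩ ht
  have htρ : 0 < t ^ ρ := Real.rpow_pos_of_pos ht ρ
  have hlo : Real.exp ((σ - ε / 2) * t ^ ρ) ≤ maxModulus f t :=
    hz2.trans (hz1 ▸ norm_le_maxModulus hf z)
  have hup : maxModulus f t ≤ Real.exp (t ^ ρ * (σ + ε / 2)) := maxModulus_le ht.le fun w hw => by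
    have htc : (t : ℂ) ≠ 0 := by exact_mod_cast ht.ne'
    have hn : ‖w / t‖ = 1 := by
      rw [norm_div, hw, Complex.norm_real, Real.norm_of_nonneg ht.le, div_self ht.ne']
    have := h1 (w / t) hn.le
    rwa [mul_div_cancel₀ _ htc, hn, Real.one_rpow, mul_one] at this
  have hpos : 0 < maxModulus f t := (Real.exp_pos _).trans_le hlo
  have h2 := (Real.le_log_iff_exp_le hpos).2 hlo
  have h3 := (Real.log_le_iff_le_exp hpos).2 hup
  rw [← le_div_iff₀ htρ] at h2
  rw [← div_le_iff₀' htρ] at h3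
  rw [Real.dist_eq, abs_lt]
  constructor <;> linarith

theorem growthType_eq_of_tendsto {f : ℂ → ℂ} {ρ σ : ℝ}
    (h : Tendsto (fun r => Real.log (maxModulus f r) / r ^ ρ) atTop (𝓝 σ)) :
    growthType ρ f = σ :=
  ((continuous_coe_real_ereal.tendsto σ).comp h).limsup_eq

theorem growthOrder_eq_of_tendsto {f : ℂ → ℂ} {ρ σ : ℝ} (hσ : 0 < σ)
    (h : Tendsto (fun r => Real.log (maxModulus f r) / r ^ ρ) atTop (𝓝 σ)) :
    growthOrder f = ρ := by
  refine ((continuous_coe_real_ereal.tendsto ρ).comp ?_).limsup_eq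
  have h1 : Tendsto (fun r => Real.log (Real.log (maxModulus f r) / r ^ ρ) / Real.log r + ρ)
      atTop (𝓝 (0 + ρ)) :=
    ((h.log hσ.ne').div_atTop Real.tendsto_log_atTop).add_const ρ
  rw [zero_add] at h1
  refine h1.congr' ?_
  filter_upwards [h.eventually (lt_mem_nhds hσ), eventually_gt_atTop 1] with r hr hr1
  have hr0 : 0 < r := by linarith
  have hrρ : 0 < r ^ ρ := Real.rpow_pos_of_pos hr0 ρ
  have hlog : 0 < Real.log r := Real.log_pos hr1
  have hL : Real.log (maxModulus f r) ≠ 0 := fun h0 => by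
    rw [h0, zero_div] at hr
    exact lt_irrefl _ hr
  rw [Real.log_div hL hrρ.ne', Real.log_rpow hr0]
  field_simp
  ring

/-! ### The indicator -/

/-- A form of the two-constants theorem: a holomorphic function which is small on a segment is
small on a disc around its midpoint. The role of the harmonic measure of the segment is
played by `Re (1 + iζ)² = (1 - y)² - x²`. -/
theorem norm_le_exp_of_le_on_segment {F : ℂ → ℂ} (hF : Differentiable ℂ F) {A η : ℝ} (hη : 0 ≤ η)
    (hA : ∀ ζ : ℂ, |ζ.re| ≤ 1 → |ζ.im| ≤ 1 → ‖F ζ‖ ≤ Real.exp A)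
    (hseg : ∀ x : ℝ, |x| ≤ 1 → ‖F x‖ ≤ Real.exp (A - η)) {ζ : ℂ} (hζ : ‖ζ‖ ≤ 1 / 4) :
    ‖F ζ‖ ≤ Real.exp (A - η / 2) := by
  wlog him : 0 ≤ ζ.im generalizing F ζ
  · have h1 := this (F := fun w => F (-w)) (hF.comp differentiable_neg)
      (fun w hw hw' => hA (-w) (by simpa using hw) (by simpa using hw'))
      (fun x hx => by simpa using hseg (-x) (by simpa using hx)) (ζ := -ζ) (by simpa using hζ)
      (by rw [Complex.neg_im]; linarith)
    simpa using h1
  have hre : ∀ w : ℂ, (η * (1 + Complex.I * w) ^ 2).re = η * ((1 - w.im) ^ 2 - w.re ^ 2) :=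
    fun w => by
      rw [Complex.re_ofReal_mul, pow_two]
      simp
      left
      ring
  set G : ℂ → ℂ := fun w => F w * Complex.exp (η * (1 + Complex.I * w) ^ 2) with hG
  have hGn : ∀ w, ‖G w‖ = ‖F w‖ * Real.exp (η * ((1 - w.im) ^ 2 - w.re ^ 2)) := fun w => by
    rw [hG, norm_mul, Complex.norm_exp, hre]
  have hGd : Differentiable ℂ G := hF.mul (by fun_prop)
  set U : Set ℂ := Set.Ioo (-1 : ℝ) 1 ×ℂ Set.Ioo (0 : ℝ) 1 with hU
  have hUb : Bornology.IsBounded U := (Metric.isBounded_Ioo _ _).reProdIm (Metric.isBounded_Ioo _ _)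
  have hfront : ∀ w ∈ frontier U, ‖G w‖ ≤ Real.exp A := by
    intro w hw
    rw [hU, Complex.frontier_reProdIm, closure_Ioo (by norm_num), closure_Ioo (by norm_num),
      frontier_Ioo (by norm_num), frontier_Ioo (by norm_num)] at hw
    rw [hGn]
    have hsmall : |w.re| ≤ 1 → |w.im| ≤ 1 → (1 - w.im) ^ 2 - w.re ^ 2 ≤ 0 →
        ‖F w‖ * Real.exp (η * ((1 - w.im) ^ 2 - w.re ^ 2)) ≤ Real.exp A := fun h1 h2 h3 => by
      have h4 : Real.exp (η * ((1 - w.im) ^ 2 - w.re ^ 2)) ≤ 1 :=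
        Real.exp_le_one_iff.2 (mul_nonpos_of_nonneg_of_nonpos hη h3)
      exact (mul_le_of_le_one_right (norm_nonneg _) h4).trans (hA w h1 h2)
    rcases hw with ⟨h1, h2⟩ | ⟨h1, h2⟩
    · have h3 : |w.re| ≤ 1 := abs_le.2 h1
      rcases h2 with h2 | h2
      · have h4 : w = (w.re : ℂ) := Complex.ext (by simp) (by simpa using h2)
        have h5 : η * ((1 - w.im) ^ 2 - w.re ^ 2) ≤ η := by
          rw [h2]
          nlinarith [sq_nonneg w.re]
        calc ‖F w‖ * Real.exp (η * ((1 - w.im) ^ 2 - w.re ^ 2))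
            ≤ Real.exp (A - η) * Real.exp η := by
              gcongr
              rw [h4]
              exact hseg _ h3
          _ = Real.exp A := by rw [← Real.exp_add, sub_add_cancel]
      · have h2' : w.im = 1 := h2
        exact hsmall h3 (by rw [h2']; simp) (by rw [h2']; nlinarith [sq_nonneg w.re])
    · have h3 : w.re ^ 2 = 1 := by
        rcases h1 with h1 | h1
        · rw [h1]; norm_num
        · rw [Set.mem_singleton_iff.1 h1]; norm_num
      have h4 : 0 ≤ w.im ∧ w.im ≤ 1 := h2
      exact hsmall (abs_le_one_iff_mul_self_le_one.2 (by nlinarith))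
        (abs_le.2 ⟨by linarith, h4.2⟩) (by nlinarith)
  have hx : |ζ.re| ≤ 1 / 4 := (Complex.abs_re_le_norm ζ).trans hζ
  have hy : |ζ.im| ≤ 1 / 4 := (Complex.abs_im_le_norm ζ).trans hζ
  have hmem : ζ ∈ closure U := by
    rw [hU, Complex.closure_reProdIm, closure_Ioo (by norm_num), closure_Ioo (by norm_num)]
    exact ⟨abs_le.1 (by linarith), him, by linarith [(abs_le.1 hy).2]⟩
  have h1 := Complex.norm_le_of_forall_mem_frontier_norm_le hUb hGd.diffContOnCl hfront hmem
  rw [hGn] at h1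
  have h2 : 1 / 2 ≤ (1 - ζ.im) ^ 2 - ζ.re ^ 2 := by
    have h3 : ζ.re ^ 2 ≤ (1 / 4) ^ 2 := sq_le_sq' (abs_le.1 hx).1 (abs_le.1 hx).2
    nlinarith [(abs_le.1 hy).2]
  have h4 : ‖F ζ‖ * Real.exp (η / 2) ≤ Real.exp A := by
    refine le_trans ?_ h1
    gcongr
    nlinarith
  rw [Real.exp_sub, le_div_iff₀ (Real.exp_pos _)]
  exact h4

/-- On every ray `|f|` is as large as `exp (τ r ^ ρ)` for arbitrarily large `r`: otherwise `f`
would be small on long segments of the ray, hence in full neighbourhoods of their midpoints. -/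
theorem frequently_exp_le_norm_on_ray {f : ℂ → ℂ} (hf : Differentiable ℂ f) {ρ σ : ℝ}
    (hρ : 0 < ρ) (hσ : 0 < σ)
    (hU : ∀ τ, σ < τ → ∃ C, ∀ z, ‖f z‖ ≤ C * Real.exp (τ * ‖z‖ ^ ρ))
    (hL : ∀ ε, 0 < ε → ∀ τ < σ, ∀ᶠ t : ℝ in atTop, ∀ θ : ℝ, ∃ w : ℂ,
      ‖w - (Real.log t + θ * Complex.I)‖ ≤ ε ∧ Real.exp (τ * t ^ ρ) ≤ ‖f (Complex.exp w)‖)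
    (θ : ℝ) {τ : ℝ} (hτ : τ < σ) :
    ∃ᶠ r : ℝ in atTop, Real.exp (τ * r ^ ρ) ≤ ‖f (r * Complex.exp (θ * Complex.I))‖ := by
  rw [Filter.Frequently]
  intro hcon
  obtain ⟨τ₁, hτ0, hττ, hτσ⟩ : ∃ τ₁, 0 < τ₁ ∧ τ ≤ τ₁ ∧ τ₁ < σ :=
    ⟨max τ (σ / 2), lt_max_of_lt_right (by linarith), le_max_left _ _,
      max_lt hτ (by linarith)⟩
  set d : ℝ := σ - τ₁ with hd
  have hd0 : 0 < d := by linarith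
  obtain ⟨s, hs0, hs1, hs⟩ : ∃ s : ℝ, 0 < s ∧ s < 1 ∧ σ * Real.exp (s * ρ) < σ + d / 8 := by
    have h1 : ∀ᶠ s in 𝓝 (0 : ℝ), σ * Real.exp (s * ρ) < σ + d / 8 :=
      ContinuousAt.eventually_lt (by fun_prop) continuousAt_const
        (by rw [zero_mul, Real.exp_zero, mul_one]; linarith)
    obtain ⟨s, ⟨h2, h3⟩, h4⟩ := (((h1.and (gt_mem_nhds one_pos)).filter_mono
      nhdsWithin_le_nhds).and (self_mem_nhdsWithin (s := Set.Ioi (0 : ℝ)))).exists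
    exact ⟨s, h4, h3, h2⟩
  obtain ⟨R₀, hR₀⟩ := eventually_atTop.1 hcon
  obtain ⟨t, h1, h2, h3, ht⟩ := ((eventually_forall_norm_le_exp hρ hU (K := Real.exp 1)
    (Real.exp_pos _) (show 0 < d / 8 by positivity)).and ((hL (s / 4) (by positivity) (σ - d / 8)
    (by linarith)).and ((eventually_ge_atTop (R₀ * Real.exp s)).and
    (eventually_gt_atTop 0)))).exists
  have htρ : 0 < t ^ ρ := Real.rpow_pos_of_pos ht ρ
  set F : ℂ → ℂ := fun ζ => f (Complex.exp (Real.log t + θ * Complex.I + s * ζ)) with hF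
  have hFd : Differentiable ℂ F := hf.comp (by fun_prop)
  set A : ℝ := t ^ ρ * (σ * Real.exp (s * ρ) + d / 8) with hA
  have hpow : ∀ x : ℝ, |x| ≤ 1 → Real.exp (s * x) ^ ρ ≤ Real.exp (s * ρ) := fun x hx => by
    rw [← Real.exp_mul]
    refine Real.exp_le_exp.2 ?_
    have := mul_le_mul_of_nonneg_left (abs_le.1 hx).2 (mul_pos hs0 hρ).le
    linarith
  have hFA : ∀ ζ : ℂ, |ζ.re| ≤ 1 → |ζ.im| ≤ 1 → ‖F ζ‖ ≤ Real.exp A := fun ζ hx _ => by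
    have h4 : F ζ = f (t * Complex.exp (θ * Complex.I + s * ζ)) := by
      simp only [hF]
      rw [add_assoc, Complex.exp_add, ← Complex.ofReal_exp, Real.exp_log ht]
    have h5 : ‖Complex.exp (θ * Complex.I + s * ζ)‖ = Real.exp (s * ζ.re) := by
      rw [Complex.norm_exp]
      simp
    rw [h4]
    refine (h1 _ ?_).trans (Real.exp_le_exp.2 ?_)
    · rw [h5]
      refine Real.exp_le_exp.2 ?_
      nlinarith [(abs_le.1 hx).2]
    · rw [h5, hA]
      have := hpow _ hx
      gcongr
  have hFs : ∀ x : ℝ, |x| ≤ 1 → ‖F x‖ ≤ Real.exp (A - t ^ ρ * d) := fun x hx => by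
    have h4 : F x = f ((t * Real.exp (s * x) : ℝ) * Complex.exp (θ * Complex.I)) := by
      simp only [hF]
      rw [add_assoc, Complex.exp_add, ← Complex.ofReal_exp, Real.exp_log ht, Complex.exp_add]
      push_cast
      ring_nf
    have h5 : R₀ ≤ t * Real.exp (s * x) := by
      have h6 : 1 ≤ Real.exp s * Real.exp (s * x) := by
        rw [← Real.exp_add]
        exact Real.one_le_exp (by nlinarith [(abs_le.1 hx).1])
      rcases le_or_gt R₀ 0 with h7 | h7
      · exact h7.trans (by positivity)
      · calc R₀ ≤ R₀ * (Real.exp s * Real.exp (s * x)) := le_mul_of_one_le_right h7.le h6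
          _ = (R₀ * Real.exp s) * Real.exp (s * x) := by ring
          _ ≤ _ := by gcongr
    rw [h4]
    refine (not_le.1 (hR₀ _ h5)).le.trans (Real.exp_le_exp.2 ?_)
    rw [Real.mul_rpow ht.le (Real.exp_pos _).le, hA]
    have h8 := hpow x hx
    have h9 : 0 < Real.exp (s * x) ^ ρ := Real.rpow_pos_of_pos (Real.exp_pos _) ρ
    have h10 : 1 ≤ Real.exp (s * ρ) := Real.one_le_exp (by positivity)
    have h11 : τ * Real.exp (s * x) ^ ρ ≤ τ₁ * Real.exp (s * ρ) :=
      (mul_le_mul_of_nonneg_right hττ h9.le).trans (mul_le_mul_of_nonneg_left h8 hτ0.le)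
    have h12 : τ * Real.exp (s * x) ^ ρ ≤ σ * Real.exp (s * ρ) + d / 8 - d := by nlinarith
    nlinarith
  obtain ⟨w, hw1, hw2⟩ := h2 θ
  have hsC : (s : ℂ) ≠ 0 := by exact_mod_cast hs0.ne'
  have h4 := norm_le_exp_of_le_on_segment hFd (mul_nonneg htρ.le hd0.le) hFA hFs
    (ζ := (w - (Real.log t + θ * Complex.I)) / s) (by
      rw [norm_div, Complex.norm_real, Real.norm_of_nonneg hs0.le, div_le_iff₀ hs0]
      linarith)
  simp only [hF] at h4
  rw [mul_div_cancel₀ _ hsC, add_sub_cancel] at h4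
  have h5 := Real.exp_le_exp.1 (hw2.trans h4)
  rw [hA] at h5
  nlinarith

theorem growthIndicator_eq_of_bounds {f : ℂ → ℂ} (hf : Differentiable ℂ f) {ρ σ : ℝ}
    (hρ : 0 < ρ) (hσ : 0 < σ)
    (hU : ∀ τ, σ < τ → ∃ C, ∀ z, ‖f z‖ ≤ C * Real.exp (τ * ‖z‖ ^ ρ))
    (hL : ∀ ε, 0 < ε → ∀ τ < σ, ∀ᶠ t : ℝ in atTop, ∀ θ : ℝ, ∃ w : ℂ,
      ‖w - (Real.log t + θ * Complex.I)‖ ≤ ε ∧ Real.exp (τ * t ^ ρ) ≤ ‖f (Complex.exp w)‖)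
    (θ : ℝ) : growthIndicator ρ f θ = σ := by
  have hlogexp : ∀ x : ℝ, ENNReal.log (ENNReal.ofReal (Real.exp x)) = (x : EReal) := fun x => by
    rw [ENNReal.log_ofReal_of_pos (Real.exp_pos x), Real.log_exp]
  have hmul : ∀ τ r : ℝ, ((r ^ ρ : ℝ) : EReal) * τ = ((τ * r ^ ρ : ℝ) : EReal) := fun τ r => by
    rw [mul_comm τ, EReal.coe_mul]
  apply le_antisymm
  · refine EReal.le_of_forall_lt_iff_le.1 fun τ hτ => limsup_le_of_le (by isBoundedDefault) ?_
    have hτ' : σ < τ := by exact_mod_cast hτ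
    filter_upwards [eventually_forall_norm_le_exp hρ hU one_pos (η := τ - σ) (by linarith),
      eventually_gt_atTop 0] with r h1 hr
    have hrρ : 0 < r ^ ρ := Real.rpow_pos_of_pos hr ρ
    have hn : ‖Complex.exp (θ * Complex.I)‖ = 1 := Complex.norm_exp_ofReal_mul_I θ
    rw [EReal.div_le_iff_le_mul (by exact_mod_cast hrρ) (EReal.coe_ne_top _), hmul, ← hlogexp,
      ← ofReal_norm]
    refine ENNReal.log_le_log (ENNReal.ofReal_le_ofReal ?_)
    have h2 := h1 _ hn.le
    rw [hn, Real.one_rpow, mul_one, add_sub_cancel] at h2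
    rwa [mul_comm τ]
  · refine EReal.ge_of_forall_gt_iff_ge.1 fun τ hτ =>
      le_limsup_of_frequently_le ?_ (by isBoundedDefault)
    have hτ' : τ < σ := by exact_mod_cast hτ
    refine ((frequently_exp_le_norm_on_ray hf hρ hσ hU hL θ hτ').and_eventually
      (eventually_gt_atTop 0)).mono fun r ⟨h1, hr⟩ => ?_
    have hrρ : 0 < r ^ ρ := Real.rpow_pos_of_pos hr ρ
    rw [EReal.le_div_iff_mul_le (by exact_mod_cast hrρ) (EReal.coe_ne_top _), mul_comm, hmul,
      ← hlogexp, ← ofReal_norm]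
    exact ENNReal.log_le_log (ENNReal.ofReal_le_ofReal h1)

theorem theorem5 (h : ℂ → ℂ) (hh : IsMinimalExponentialType h)
    (ρ c : ℝ) (hρ : 0 < ρ)
    (hc : (fun n : ℕ => -Real.log ‖prodCoeff h n‖ - (1 / ρ * n * Real.log n - c * n))
      =o[atTop] fun n : ℕ => (n : ℝ))
    (α : ℝ) (hα : Irrational α) :
    ∃ f : ℂ → ℂ,
      (∀ z : ℂ, HasSum
        (fun n : ℕ => prodCoeff h n * Complex.exp (2 * Real.pi * Complex.I * n ^ 2 * α) * z ^ n)
        (f z)) ∧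
      Differentiable ℂ f ∧
      growthOrder f = ρ ∧
      HasNormalType ρ f ∧
      HasCompletelyRegularGrowth ρ f ∧
      HasConstantIndicator ρ f := by
  obtain ⟨f, hf, hU, hlow⟩ := exists_hasSum_series (α := α) hρ hc
  set σ : ℝ := Real.exp (ρ * c - 1) / ρ with hσ_def
  have hσ : 0 < σ := by positivity
  have hd : Differentiable ℂ f := differentiable_of_hasSum hf
  have hirr : Irrational (2 * α) := by exact_mod_cast hα.natCast_mul two_ne_zero
  have hL : ∀ ε, 0 < ε → ∀ τ < σ, ∀ᶠ t : ℝ in atTop, ∀ θ : ℝ, ∃ w : ℂ,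
      ‖w - (Real.log t + θ * Complex.I)‖ ≤ ε ∧ Real.exp (τ * t ^ ρ) ≤ ‖f (Complex.exp w)‖ :=
    fun ε hε τ hτ => eventually_forall_exists_large (K := ‖prodCoeff h 0‖) hρ hσ hirr
      (fun δ hδ => by
        rw [show 2 * Real.pi * (2 * α) = 4 * Real.pi * α by ring]
        exact exists_norm_le_of_shift hh hf hδ) hlow hε hτ
  have hM := tendsto_log_maxModulus_div hd.continuous hρ hU hlow
  have htype := growthType_eq_of_tendsto hM
  refine ⟨f, hf, hd, growthOrder_eq_of_tendsto hσ hM, ⟨?_, ?_⟩,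
    hasCompletelyRegularGrowth_of_bounds hd hρ hσ hU hL, σ,
    growthIndicator_eq_of_bounds hd hρ hσ hU hL⟩
  · rw [htype]
    exact_mod_cast hσ
  · rw [htype]
    exact EReal.coe_lt_top σ
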